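/- Let $M$ be a connected smooth surface (Hausdorff, second countable, without boundary) and let $\nabla$ be a smooth torsion-free connection on $TM$ with curvature operator $R(X,Y)=\nabla_X\nabla_Y-\nabla_Y\nabla_X-\nabla_{[X,Y]}$. Suppose that $\mathcal M=(M,\nabla)$ is locally symmetric, i.e. $\nabla R=0$. A coordinate atlas is a family of charts of the smooth structure of $M$ whose domains cover $M$; the Christoffel symbols of a chart are given by $\nabla_{\partial_i}\partial_j=\Gamma_{ij}{}^k\partial_k$. A coordinate atlas is called * of Type $\mathcal A$ if in each chart the $\Gamma_{ij}{}^k$ are constant; * of Type $\mathcal B$ if in each chart $x^1>0$ and $\Gamma_{ij}{}^k=(x^1)^{-1}C_{ij}{}^k$ with $C_{ij}{}^k$ constant; * of Type $\mathcal C$ if on each chart domain $\nabla$ is the Levi-Civita connection of a smooth (Riemannian or pseudo-Riemannian) metric of constant Gauss curvature; * a Type $\mathcal C$ model atlas if in each chart $\nabla$ is the Levi-Civita connection of one of the four model metrics: the flat metric $(dx^1)^2+(dx^2)^2$, the sphere metric $4\,\frac{(dx^1)^2+(dx^2)^2}{(1+(x^1)^2+(x^2)^2)^2}$, or, with $x^1>0$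 on the chart, one of the metrics $\frac{(dx^1)^2\pm(dx^2)^2}{(x^1)^2}$ of the hyperbolic plane $\mathbb H^2$ ($+$) and the Lorentzian hyperbolic plane $\mathbb L^2$ ($-$); * real analytic if all transition maps between its charts are real analytic and the Christoffel symbols of $\nabla$ are real analytic in each of its charts. Then $\mathcal M$ is real analytic as soon as it is covered by a Type $\mathcal A$, $\mathcal B$ or $\mathcal C$ coordinate atlas. More precisely: 1. every Type $\mathcal A$ coordinate atlas of $\mathcal M$ is real analytic; 2. every Type $\mathcal B$ coordinate atlas of $\mathcal M$ is real analytic; 3. if $\mathcal M$ has a Type $\mathcal C$ coordinate atlas, then $\mathcal M$ has a Type $\mathcal C$ model atlas which is real analytic; every Type $\mathcal C$ model atlas of $\mathcal M$ is real analytic; and so is every Type $\mathcal C$ coordinate atlas in whose charts the metrics have real analytic components. -/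

import Mathlib

open scoped Manifold ContDiff Bundle

noncomputable section

namespace AffineSurface

/-- The model plane `ℝ²`. -/
abbrev Plane : Type := EuclideanSpace ℝ (Fin 2)

section Manifold

variable {M : Type*} [TopologicalSpace M] [ChartedSpace Plane M]

/-- Connections on the tangent bundle of the surface `M`. Mathlib writes `cov Y x (X x)` for
the value at `x` of `∇_X Y`. -/
abbrev Connection (M : Type*) [TopologicalSpace M] [ChartedSpace Plane M]
    [IsManifold (𝓡 2) ∞ M] : Type _ :=
  CovariantDerivative (𝓡 2) Plane (fun x : M => TangentSpace (𝓡 2) x)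

variable [IsManifold (𝓡 2) ∞ M]

/-- Smoothness of a vector field. -/
def IsSmoothField (X : Π x : M, TangentSpace (𝓡 2) x) : Prop :=
  ContMDiff (𝓡 2) (𝓡 2).tangent ∞ (fun x => (⟨x, X x⟩ : TangentBundle (𝓡 2) M))

/-- The vector field `∇_X Y`. -/
def nabla (cov : Connection M) (X Y : Π x : M, TangentSpace (𝓡 2) x) :
    Π x : M, TangentSpace (𝓡 2) x :=
  fun x => cov Y x (X x)

/-- The curvature operator `R(X,Y)Z = ∇_X ∇_Y Z - ∇_Y ∇_X Z - ∇_[X,Y] Z`. -/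
def curvature (cov : Connection M) (X Y Z : Π x : M, TangentSpace (𝓡 2) x) :
    Π x : M, TangentSpace (𝓡 2) x :=
  nabla cov X (nabla cov Y Z) - nabla cov Y (nabla cov X Z)
    - nabla cov (VectorField.mlieBracket (𝓡 2) X Y) Z

/-- `∇R = 0`: for all smooth vector fields,
`(∇_W R)(X,Y)Z = ∇_W (R(X,Y)Z) - R(∇_W X,Y)Z - R(X,∇_W Y)Z - R(X,Y)∇_W Z` vanishes. -/
def IsLocallySymmetric (cov : Connection M) : Prop :=
  ∀ W X Y Z : Π x : M, TangentSpace (𝓡 2) x,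
    IsSmoothField W → IsSmoothField X → IsSmoothField Y → IsSmoothField Z →
      nabla cov W (curvature cov X Y Z) - curvature cov (nabla cov W X) Y Z
        - curvature cov X (nabla cov W Y) Z - curvature cov X Y (nabla cov W Z) = 0

/-- The coordinate vector field `∂_j` of the chart `e` (meaningful on `e.source`). -/
def coordField (e : OpenPartialHomeomorph M Plane) (j : Fin 2) :
    Π p : M, TangentSpace (𝓡 2) p :=
  fun p => mfderiv (𝓡 2) (𝓡 2) e.symm (e p) (EuclideanSpace.single j (1 : ℝ))

/-- The Christoffel symbol `Γ_ij^k` of `∇` in the chart `e`, as a function of the coordinates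
(meaningful on `e.target`): the `k`-th coordinate of `∇_{∂_i} ∂_j`. -/
def christoffel (cov : Connection M) (e : OpenPartialHomeomorph M Plane) (i j k : Fin 2)
    (x : Plane) : ℝ :=
  (show Plane from
    mfderiv (𝓡 2) (𝓡 2) e (e.symm x) (nabla cov (coordField e i) (coordField e j) (e.symm x))) k

/-- A coordinate atlas of the smooth surface `M`: a family of charts of the smooth structure
whose domains cover `M`. -/
def IsCoordinateAtlas (𝒜 : Set (OpenPartialHomeomorph M Plane)) : Prop :=
  𝒜 ⊆ IsManifold.maximalAtlas (𝓡 2) ∞ M ∧ ∀ p : M, ∃ e ∈ 𝒜, p ∈ e.source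

/-- A Type A coordinate atlas: in each chart the Christoffel symbols are constant. -/
def IsTypeAAtlas (cov : Connection M) (𝒜 : Set (OpenPartialHomeomorph M Plane)) : Prop :=
  IsCoordinateAtlas 𝒜 ∧ ∀ e ∈ 𝒜, ∃ C : Fin 2 → Fin 2 → Fin 2 → ℝ,
    ∀ x ∈ e.target, ∀ i j k, christoffel cov e i j k x = C i j k

/-- A Type B coordinate atlas: in each chart `x¹ > 0` and `Γ_ij^k = (x¹)⁻¹ C_ij^k` with
constants `C_ij^k`. -/
def IsTypeBAtlas (cov : Connection M) (𝒜 : Set (OpenPartialHomeomorph M Plane)) : Prop :=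
  IsCoordinateAtlas 𝒜 ∧ ∀ e ∈ 𝒜, ∃ C : Fin 2 → Fin 2 → Fin 2 → ℝ,
    ∀ x ∈ e.target, 0 < x 0 ∧ ∀ i j k, christoffel cov e i j k x = (x 0)⁻¹ * C i j k

/-- The partial derivative `∂_i f`. -/
def pderiv (i : Fin 2) (f : Plane → ℝ) (x : Plane) : ℝ :=
  fderiv ℝ f x (EuclideanSpace.single i (1 : ℝ))

/-- `∇ g = 0` in the chart `e`, for the field of bilinear forms with components `g x i j`:
`∂_l g_ij = Γ_li^m g_mj + Γ_lj^m g_im`. For a torsion-free `∇` and a metric `g` this says that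
`∇` is the Levi-Civita connection of `g` on the domain of `e`. -/
def IsMetricInChart (cov : Connection M) (e : OpenPartialHomeomorph M Plane)
    (g : Plane → Matrix (Fin 2) (Fin 2) ℝ) : Prop :=
  ∀ x ∈ e.target, ∀ l i j : Fin 2,
    pderiv l (fun y => g y i j) x =
      ∑ m, (christoffel cov e l i m x * g x m j + christoffel cov e l j m x * g x i m)

/-- The component `R_ijk^l` of the curvature in the chart `e`:
`R(∂_i,∂_j)∂_k = R_ijk^l ∂_l`. -/
def curvatureComponent (cov : Connection M) (e : OpenPartialHomeomorph M Plane)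
    (i j k l : Fin 2) (x : Plane) : ℝ :=
  pderiv i (christoffel cov e j k l) x - pderiv j (christoffel cov e i k l) x
    + ∑ m, (christoffel cov e i m l x * christoffel cov e j k m x
      - christoffel cov e j m l x * christoffel cov e i k m x)

/-- The Gauss curvature of the metric `g` whose Levi-Civita connection is `∇`, in the chart `e`:
`K = g(R(∂_1,∂_2)∂_2,∂_1) / (g_11 g_22 - g_12 g_21)`. -/
def gaussCurvature (cov : Connection M) (e : OpenPartialHomeomorph M Plane)
    (g : Plane → Matrix (Fin 2) (Fin 2) ℝ) (x : Plane) : ℝ :=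
  (∑ l, curvatureComponent cov e 0 1 1 l x * g x l 0) / (g x).det

/-- A Type C coordinate atlas whose metrics have components of class `C^n`: over each chart the
torsion-free connection `∇` is the Levi-Civita connection of a (possibly indefinite) metric of
constant Gauss curvature. -/
def IsTypeCAtlas (n : WithTop ℕ∞) (cov : Connection M)
    (𝒜 : Set (OpenPartialHomeomorph M Plane)) : Prop :=
  IsCoordinateAtlas 𝒜 ∧ ∀ e ∈ 𝒜, ∃ (g : Plane → Matrix (Fin 2) (Fin 2) ℝ) (K : ℝ),
    (∀ i j, ContDiffOn ℝ n (fun x => g x i j) e.target) ∧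
    (∀ x ∈ e.target, (g x).IsSymm ∧ (g x).det ≠ 0) ∧
    IsMetricInChart cov e g ∧
    ∀ x ∈ e.target, gaussCurvature cov e g x = K

/-- The flat metric `(dx¹)² + (dx²)²`. -/
def flatMetric (_ : Plane) : Matrix (Fin 2) (Fin 2) ℝ := 1

/-- The round metric of the unit sphere in a stereographic coordinate,
`4 ((dx¹)² + (dx²)²) / (1 + |x|²)²`. -/
def sphereMetric (x : Plane) : Matrix (Fin 2) (Fin 2) ℝ :=
  (4 / (1 + (x 0 ^ 2 + x 1 ^ 2)) ^ 2) • (1 : Matrix (Fin 2) (Fin 2) ℝ)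

/-- The metric `((dx¹)² + ε (dx²)²) / (x¹)²` on the half plane `x¹ > 0`. It is the hyperbolic
plane for `ε = 1` and the Lorentzian hyperbolic plane for `ε = -1`. -/
def halfPlaneMetric (ε : ℝ) (x : Plane) : Matrix (Fin 2) (Fin 2) ℝ :=
  ((x 0 ^ 2)⁻¹) • !![1, 0; 0, ε]

/-- A coordinate atlas each of whose charts is modelled, as a surface with connection, on an open
piece of the flat plane, the sphere, the hyperbolic plane or the Lorentzian hyperbolic plane. -/
def IsTypeCModelAtlas (cov : Connection M) (𝒜 : Set (OpenPartialHomeomorph M Plane)) : Prop :=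
  IsCoordinateAtlas 𝒜 ∧ ∀ e ∈ 𝒜,
    IsMetricInChart cov e flatMetric ∨
    IsMetricInChart cov e sphereMetric ∨
    ((∀ x ∈ e.target, 0 < x 0) ∧ IsMetricInChart cov e (halfPlaneMetric 1)) ∨
    ((∀ x ∈ e.target, 0 < x 0) ∧ IsMetricInChart cov e (halfPlaneMetric (-1)))

/-- The coordinate atlas `𝒜` makes `(M, ∇)` real analytic: all transition maps are real analytic
and `∇` has real analytic Christoffel symbols in all charts of `𝒜`. -/
def IsRealAnalyticAtlas (cov : Connection M) (𝒜 : Set (OpenPartialHomeomorph M Plane)) : Prop :=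
  IsCoordinateAtlas 𝒜 ∧
  (∀ e ∈ 𝒜, ∀ e' ∈ 𝒜, e.symm.trans e' ∈ contDiffGroupoid ω (𝓡 2)) ∧
  ∀ e ∈ 𝒜, ∀ i j k, AnalyticOnNhd ℝ (christoffel cov e i j k) e.target

end Manifold

end AffineSurface

end

/-!
The Christoffel symbols of two overlapping charts are related by a transformation law which
expresses the second partial derivatives of the transition map through the Christoffel symbols and
the first partial derivatives. So the transition map, together with its first partial derivatives,
solves a total differential equation `Du = F(u)`, and `F` is real analytic if the Christoffel
symbols are (`christoffel_transform`, `analyticAt_transition`). Solutions of such equations are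
real analytic (`analyticAt_of_eventually_hasFDerivAt`), hence an atlas is real analytic as soon as
its Christoffel symbols are. For atlases of Type A and B this is immediate, and for a parallel real
analytic metric it follows from the Koszul formula (`koszul_formula`).

For the existence of a model atlas, let `g` be a parallel metric of constant Gauss curvature `K` in
some chart. The equation `∇df = -K f g` is equivalent to a total differential equation for `f` and
`df`, whose integrability condition is exactly that the curvature is constant
(`fderiv_hessianSystem_symm`). By the Frobenius theorem (`exists_eventually_hasFDerivAt`) it
therefore has local solutions with arbitrary value and differential at a point
(`exists_isHessianSolution`). For two solutions `f` and `h` the function `⟨df, dh⟩ + K f h` is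
constant (`IsHessianSolution.eventually_conserved`), so the inner products of the differentials of
solutions are known functions of the solutions. On the sphere or on the hyperboloids in
three-dimensional space the solutions are the linear functions, and the model coordinates are
fractional linear expressions in them. The same expressions, formed from solutions with suitable
initial data, give a local isometry of a constant multiple of `g` to a model metric
(`exists_isLocalIsometry`). Since a connection does not change when its parallel metric is
multiplied by a constant, these maps are charts of a model atlas.

The theorems on total differential equations are proved with the implicit function theorem in the
Banach space of continuous paths. Along a ray, the equation `Du = F(u)` becomes an ordinary
differential equation in which the direction of the ray can be treated as a conserved unknown. Its
integral form is a fixed point equation for paths, whose defining map `rayMap` is as regular as `F`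
and has an invertible derivative at the constant paths. So the solution depends on the direction of
the ray as regularly as `F` allows.
-/

noncomputable section

namespace AffineSurface

open Filter Topology Set

/-! ### Superposition operators on spaces of continuous maps -/

section Superposition

variable {X Y Z : Type*} [TopologicalSpace X] [CompactSpace X]
  [NormedAddCommGroup Y] [NormedSpace ℝ Y] [NormedAddCommGroup Z] [NormedSpace ℝ Z]

/-- Pointwise application of a bounded bilinear map to two continuous families of vectors. -/
def pointwiseBilinear {W : Type*} [NormedAddCommGroup W] [NormedSpace ℝ W]
    (b : W →L[ℝ] Y →L[ℝ] Z) : C(X, W) →L[ℝ] C(X, Y) →L[ℝ] C(X, Z) :=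
  LinearMap.mkContinuous₂
    (LinearMap.mk₂ ℝ (fun (B : C(X, W)) (w : C(X, Y)) =>
        (⟨fun t => b (B t) (w t), by fun_prop⟩ : C(X, Z)))
      (fun _ _ _ => by ext; simp) (fun _ _ _ => by ext; simp)
      (fun _ _ _ => by ext; simp) (fun _ _ _ => by ext; simp)) ‖b‖
    (fun B w => by
      rw [ContinuousMap.norm_le _ (by positivity)]
      intro t
      refine (b.le_opNorm₂ _ _).trans ?_
      gcongr
      · exact B.norm_coe_le_norm t
      · exact w.norm_coe_le_norm t)

/-- Pointwise application of a continuous family of operators to a continuous family of vectors. -/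
def pointwiseApply : C(X, Y →L[ℝ] Z) →L[ℝ] C(X, Y) →L[ℝ] C(X, Z) :=
  pointwiseBilinear (ContinuousLinearMap.id ℝ (Y →L[ℝ] Z))

@[simp]
lemma pointwiseApply_apply (B : C(X, Y →L[ℝ] Z)) (w : C(X, Y)) (t : X) :
    pointwiseApply B w t = B t (w t) := rfl

/-- The multilinear map on continuous families of vectors that applies `q` pointwise. -/
def pointwiseMultilinear {n : ℕ} (q : Y [×n]→L[ℝ] Z) : C(X, Y) [×n]→L[ℝ] C(X, Z) :=
  MultilinearMap.mkContinuous
    { toFun := fun w => ⟨fun t => q (fun i => w i t), by fun_prop⟩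
      map_update_add' := by
        intro _ m i x y
        ext t
        have h (z : C(X, Y)) : (fun j => Function.update m i z j t) =
            Function.update (fun j => m j t) i (z t) := by
          ext j
          by_cases hj : j = i
          · subst hj; simp
          · simp [hj]
        simp [h]
      map_update_smul' := by
        intro _ m i c x
        ext t
        have h (z : C(X, Y)) : (fun j => Function.update m i z j t) =
            Function.update (fun j => m j t) i (z t) := by
          ext j
          by_cases hj : j = i
          · subst hj; simp
          · simp [hj]
        simp [h] } ‖q‖
    (fun w => by
      rw [ContinuousMap.norm_le _ (by positivity)]
      intro t
      refine (q.le_opNorm _).trans ?_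
      gcongr with i
      exact (w i).norm_coe_le_norm t)

lemma norm_pointwiseMultilinear_le {n : ℕ} (q : Y [×n]→L[ℝ] Z) :
    ‖(pointwiseMultilinear q : C(X, Y) [×n]→L[ℝ] C(X, Z))‖ ≤ ‖q‖ :=
  MultilinearMap.mkContinuous_norm_le _ (norm_nonneg _) _

/-- Composition with a function `H` that is analytic at `c` is an analytic operation on continuous
maps near the constant map `c`: the power series of `H` is applied pointwise. -/
lemma analyticAt_comp_left [CompleteSpace Z] {H : C(Y, Z)} {c : Y} (hH : AnalyticAt ℝ H c) :
    AnalyticAt ℝ (fun w : C(X, Y) => H.comp w) (ContinuousMap.const X c) := by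
  obtain ⟨p, r, hp⟩ := hH
  refine ⟨fun n => pointwiseMultilinear (p n), r, ⟨hp.r_le.trans
    (FormalMultilinearSeries.radius_le_of_le fun n => norm_pointwiseMultilinear_le _),
    hp.r_pos, ?_⟩⟩
  intro y hy
  have hy' : ‖y‖ₑ < r := by simpa [edist_zero_right] using hy
  have hsum : Summable fun n => (pointwiseMultilinear (p n) : C(X, Y) [×n]→L[ℝ] C(X, Z))
      (fun _ => y) := by
    refine Summable.of_norm_bounded (g := fun n => ‖p n‖ * ‖y‖ ^ n) ?_ ?_
    · have := p.summable_norm_mul_pow (r := ‖y‖₊) (lt_of_lt_of_le hy' hp.r_le)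
      simpa using this
    · intro n
      refine (ContinuousMultilinearMap.le_opNorm _ _).trans ?_
      simp only [Finset.prod_const, Finset.card_univ, Fintype.card_fin]
      gcongr
      exact norm_pointwiseMultilinear_le _
  convert! hsum.hasSum
  ext t
  refine Eq.trans ?_ (ContinuousMap.tsum_apply hsum t)
  have ht : y t ∈ Metric.eball (0 : Y) r := by
    rw [Metric.mem_eball, edist_zero_right]
    refine lt_of_le_of_lt ?_ hy'
    rw [enorm_le_iff_norm_le]
    exact y.norm_coe_le_norm t
  exact (hp.hasSum ht).tsum_eq.symm

/-- Composition with a continuously differentiable function is a differentiable operation on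
continuous maps. -/
lemma hasFDerivAt_comp_left {H : C(Y, Z)} {H' : C(Y, Y →L[ℝ] Z)}
    (hH : ∀ y, HasFDerivAt H (H' y) y) (w : C(X, Y)) :
    HasFDerivAt (fun w : C(X, Y) => H.comp w) (pointwiseApply (H'.comp w)) w := by
  rw [hasFDerivAt_iff_isLittleO_nhds_zero, Asymptotics.isLittleO_iff]
  intro ε hε
  have hu := (isCompact_range w.continuous).uniformContinuousAt_of_continuousAt H'
    (fun y _ => H'.continuous.continuousAt) (Metric.dist_mem_uniformity hε)
  obtain ⟨δ, hδ, hδ'⟩ := Metric.mem_uniformity_dist.1 hu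
  filter_upwards [Metric.ball_mem_nhds (0 : C(X, Y)) hδ] with h hh
  have hh' : ‖h‖ < δ := by simpa using hh
  rw [ContinuousMap.norm_le _ (by positivity)]
  intro t
  have hb : ∀ z ∈ Metric.ball (w t) δ, ‖H' z - H' (w t)‖ ≤ ε := fun z hz => by
    have := hδ' (a := w t) (b := z) (by rwa [dist_comm]) (mem_range_self t)
    rw [← dist_eq_norm, dist_comm]
    exact le_of_lt this
  have hz : w t + h t ∈ Metric.ball (w t) δ := by
    simpa using lt_of_le_of_lt (h.norm_coe_le_norm t) hh'
  have := (convex_ball (w t) δ).norm_image_sub_le_of_norm_hasFDerivWithin_le'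
    (fun z _ => (hH z).hasFDerivWithinAt) hb (Metric.mem_ball_self hδ) hz
  simp only [add_sub_cancel_left] at this
  change ‖H (w t + h t) - H (w t) - H' (w t) (h t)‖ ≤ ε * ‖h‖
  refine this.trans ?_
  gcongr
  exact h.norm_coe_le_norm t

end Superposition

/-! ### The integration operator on paths -/

section Integral

variable {E : Type*} [NormedAddCommGroup E] [NormedSpace ℝ E]

/-- The primitive vanishing at `0`, as a bounded operator on continuous paths. -/
def primitive : C(unitInterval, E) →L[ℝ] C(unitInterval, E) :=
  LinearMap.mkContinuous
    { toFun := fun v => ⟨fun s => ∫ t in (0 : ℝ)..s, IccExtend zero_le_one v t,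
        (intervalIntegral.continuous_primitive
          (fun _ _ => v.continuous.Icc_extend'.intervalIntegrable _ _) 0).comp
            continuous_subtype_val⟩
      map_add' := fun v w => by
        ext s
        exact intervalIntegral.integral_add (v.continuous.Icc_extend'.intervalIntegrable _ _)
          (w.continuous.Icc_extend'.intervalIntegrable _ _)
      map_smul' := fun c v => by
        ext s
        exact intervalIntegral.integral_smul c _ } 1
    (fun v => by
      rw [ContinuousMap.norm_le _ (by positivity)]
      intro s
      refine (intervalIntegral.norm_integral_le_of_norm_le_const
        (C := ‖v‖) fun t _ => v.norm_coe_le_norm _).trans ?_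
      rw [sub_zero, abs_of_nonneg s.2.1, mul_comm]
      gcongr
      exact s.2.2)

lemma primitive_apply (v : C(unitInterval, E)) (s : unitInterval) :
    primitive v s = ∫ t in (0 : ℝ)..s, IccExtend zero_le_one v t := rfl

lemma map_primitive {G : Type*} [NormedAddCommGroup G] [NormedSpace ℝ G] [CompleteSpace E]
    [CompleteSpace G] (L : E →L[ℝ] G) (v : C(unitInterval, E)) (s : unitInterval) :
    L (primitive v s) = primitive ((L : C(E, G)).comp v) s := by
  rw [primitive_apply, primitive_apply, ← L.intervalIntegral_comp_comm
    (v.continuous.Icc_extend'.intervalIntegrable _ _)]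
  rfl

lemma primitive_eq_of_hasDerivAt [CompleteSpace E] {v : C(unitInterval, E)} {f : ℝ → E}
    (hf : ∀ t : unitInterval, HasDerivAt f (v t) t) (s : unitInterval) :
    primitive v s = f s - f 0 := by
  rw [primitive_apply]
  apply intervalIntegral.integral_eq_sub_of_hasDerivAt
  · intro t ht
    rw [uIcc_of_le s.2.1] at ht
    have ht' : t ∈ Icc (0 : ℝ) 1 := ⟨ht.1, ht.2.trans s.2.2⟩
    rw [IccExtend_of_mem _ _ ht']
    exact hf ⟨t, ht'⟩
  · exact v.continuous.Icc_extend'.intervalIntegrable _ _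

lemma hasDerivAt_integral_IccExtend [CompleteSpace E] (v : C(unitInterval, E)) (t : ℝ) :
    HasDerivAt (fun s => ∫ t in (0 : ℝ)..s, IccExtend zero_le_one v t)
      (IccExtend zero_le_one v t) t :=
  intervalIntegral.integral_hasDerivAt_right (v.continuous.Icc_extend'.intervalIntegrable _ _)
    (v.continuous.Icc_extend'.stronglyMeasurableAtFilter _ _)
    v.continuous.Icc_extend'.continuousAt

end Integral

/-! ### Total differential equations along rays -/

section Cutoff

variable {E G : Type*} [NormedAddCommGroup E] [NormedSpace ℝ E] [FiniteDimensional ℝ E]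
  [NormedAddCommGroup G] [NormedSpace ℝ G]

/-- Superposition operators need a globally defined function: this lemma supplies one. -/
lemma exists_contDiff_eventuallyEq {F : E → G} {c : E} (hF : ContDiffAt ℝ 1 F c) :
    ∃ F₁ : E → G, ContDiff ℝ 1 F₁ ∧ F₁ =ᶠ[𝓝 c] F := by
  obtain ⟨ε, hε, hball⟩ := Metric.eventually_nhds_iff_ball.1 (hF.eventually (by simp))
  let χ : ContDiffBump c := ⟨ε / 4, ε / 2, by positivity, by linarith⟩
  refine ⟨fun y => χ y • F y, ?_, ?_⟩
  · rw [contDiff_iff_contDiffAt]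
    intro y
    by_cases hy : y ∈ Metric.ball c ε
    · exact χ.contDiff.contDiffAt.smul (hball y hy)
    · have hy' : y ∉ tsupport χ := by
        rw [χ.tsupport_eq, Metric.mem_closedBall]
        change ¬ dist y c ≤ ε / 2
        rw [Metric.mem_ball] at hy
        linarith
      refine (contDiffAt_const (c := (0 : G))).congr_of_eventuallyEq ?_
      filter_upwards [notMem_tsupport_iff_eventuallyEq.1 hy'] with z hz
      simp [hz]
  · filter_upwards [χ.eventuallyEq_one] with y hy
    simp [hy]

end Cutoff

section Ray

variable {P E : Type*} [NormedAddCommGroup P] [NormedSpace ℝ P]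
  [NormedAddCommGroup E] [NormedSpace ℝ E] {F : E → P →L[ℝ] E}

/-- The vector field whose integral curve issuing from `(h, v)` has constant first component and,
in the second, the solution along the ray of direction `h` of the total differential equation
`Du = F(u)`. -/
def rayField (F : E → P →L[ℝ] E) (y : P × E) : P × E := (0, F y.2 y.1)

/-- The derivative of `rayField F`. -/
def rayFieldDeriv (F : E → P →L[ℝ] E) (y : P × E) : P × E →L[ℝ] P × E :=
  (ContinuousLinearMap.inr ℝ P E).comp
    ((F y.2).comp (ContinuousLinearMap.fst ℝ P E) +
      ((fderiv ℝ F y.2).flip y.1).comp (ContinuousLinearMap.snd ℝ P E))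

@[simp]
lemma rayFieldDeriv_apply (y z : P × E) :
    rayFieldDeriv F y z = (0, F y.2 z.1 + fderiv ℝ F y.2 z.2 y.1) := by
  simp [rayFieldDeriv]

lemma hasFDerivAt_rayField (hF : ContDiff ℝ 1 F) (y : P × E) :
    HasFDerivAt (rayField F) (rayFieldDeriv F y) y := by
  have h1 : HasFDerivAt F (fderiv ℝ F y.2) y.2 :=
    (hF.differentiable one_ne_zero).differentiableAt.hasFDerivAt
  have h2 := (h1.comp y hasFDerivAt_snd).clm_apply (hasFDerivAt_fst (p := y) (𝕜 := ℝ))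
  have h3 := (hasFDerivAt_const (0 : P) y).prodMk h2
  refine h3.congr_fderiv ?_
  ext z <;> simp [rayFieldDeriv_apply]

lemma continuous_rayField (hF : ContDiff ℝ 1 F) : Continuous (rayField F) :=
  continuous_iff_continuousAt.2 fun y => (hasFDerivAt_rayField hF y).continuousAt

lemma continuous_rayFieldDeriv (hF : ContDiff ℝ 1 F) : Continuous (rayFieldDeriv F) := by
  have h1 := hF.continuous
  have h2 : Continuous (fderiv ℝ F) := hF.continuous_fderiv one_ne_zero
  have h3 : Continuous fun y : P × E => (fderiv ℝ F y.2).flip :=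
    (ContinuousLinearMap.flipₗᵢ ℝ E P E).continuous.comp (h2.comp continuous_snd)
  have h4 : Continuous fun y : P × E => (fderiv ℝ F y.2).flip y.1 := h3.clm_apply continuous_fst
  unfold rayFieldDeriv
  exact continuous_const.clm_comp (((h1.comp continuous_snd).clm_comp continuous_const).add
    (h4.clm_comp continuous_const))

/-- A path `w` in `P × E` is an integral curve of `rayField F` if and only if `rayMap hF w` is the
constant path at its starting point. -/
def rayMap (hF : ContDiff ℝ 1 F) (w : C(unitInterval, P × E)) : C(unitInterval, P × E) :=
  w - primitive ((⟨rayField F, continuous_rayField hF⟩ : C(P × E, P × E)).comp w)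

/-- The derivative of `rayMap hF`. -/
def rayMapDeriv (hF : ContDiff ℝ 1 F) (w : C(unitInterval, P × E)) :
    C(unitInterval, P × E) →L[ℝ] C(unitInterval, P × E) :=
  1 - primitive.comp (pointwiseApply
    ((⟨rayFieldDeriv F, continuous_rayFieldDeriv hF⟩ : C(P × E, P × E →L[ℝ] P × E)).comp w))

lemma hasFDerivAt_rayMap (hF : ContDiff ℝ 1 F) (w : C(unitInterval, P × E)) :
    HasFDerivAt (rayMap hF) (rayMapDeriv hF w) w :=
  (hasFDerivAt_id w).sub ((ContinuousLinearMap.hasFDerivAt (primitive (E := P × E))).comp w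
    (hasFDerivAt_comp_left (H := ⟨rayField F, continuous_rayField hF⟩)
      (H' := ⟨rayFieldDeriv F, continuous_rayFieldDeriv hF⟩) (hasFDerivAt_rayField hF) w))

set_option synthInstance.maxHeartbeats 200000 in
lemma continuous_rayMapDeriv (hF : ContDiff ℝ 1 F) : Continuous (rayMapDeriv hF) := by
  unfold rayMapDeriv
  exact continuous_const.sub (continuous_const.clm_comp
    (pointwiseApply.continuous.comp (ContinuousMap.continuous_postcomp _)))

lemma contDiff_rayMap (hF : ContDiff ℝ 1 F) : ContDiff ℝ 1 (rayMap hF) :=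
  contDiff_one_iff_hasFDerivAt.2 ⟨_, continuous_rayMapDeriv hF, hasFDerivAt_rayMap hF⟩

lemma analyticAt_rayMap [CompleteSpace P] [CompleteSpace E] (hF : ContDiff ℝ 1 F) {v : E}
    (hv : AnalyticAt ℝ F v) :
    AnalyticAt ℝ (rayMap hF) (ContinuousMap.const unitInterval ((0 : P), v)) := by
  have h1 : AnalyticAt ℝ (rayField F) ((0 : P), v) :=
    (contDiffAt_const.prodMk ((ContDiffAt.comp (g := F) ((0 : P), v) hv.contDiffAt
      contDiffAt_snd).clm_apply contDiffAt_fst)).analyticAt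
  exact analyticAt_id.sub ((primitive.analyticAt _).comp
    (analyticAt_comp_left (H := ⟨rayField F, continuous_rayField hF⟩) h1))

/-- At a constant path with vanishing direction the derivative of `rayMap` differs from the
identity by an operator of square zero. -/
lemma isUnit_rayMapDeriv_const [CompleteSpace P] [CompleteSpace E] (hF : ContDiff ℝ 1 F) (v : E) :
    IsUnit (rayMapDeriv hF (ContinuousMap.const unitInterval ((0 : P), v))) := by
  unfold rayMapDeriv
  apply IsNilpotent.isUnit_one_sub
  refine ⟨2, ?_⟩
  have h0 (z : C(unitInterval, P × E)) (hz : ∀ t, (z t).1 = 0) : pointwiseApply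
      ((⟨rayFieldDeriv F, continuous_rayFieldDeriv hF⟩ : C(P × E, P × E →L[ℝ] P × E)).comp
        (ContinuousMap.const unitInterval ((0 : P), v))) z = 0 := by
    ext t <;> simp [hz]
  rw [pow_two]
  ext1 z
  rw [ContinuousLinearMap.mul_def, ContinuousLinearMap.comp_apply, ContinuousLinearMap.comp_apply]
  -- the operator kills paths with vanishing first component, and all its values are such paths
  rw [h0, map_zero]
  · rfl
  intro t
  rw [ContinuousLinearMap.comp_apply]
  refine (map_primitive (ContinuousLinearMap.fst ℝ P E) _ t).trans ?_
  convert! congrArg (fun q : C(unitInterval, P) => q t) (map_zero primitive) using 3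

lemma rayMap_const (hF : ContDiff ℝ 1 F) (v : E) :
    rayMap hF (ContinuousMap.const unitInterval ((0 : P), v)) = ContinuousMap.const _ (0, v) := by
  have : (⟨rayField F, continuous_rayField hF⟩ : C(P × E, P × E)).comp
      (ContinuousMap.const unitInterval ((0 : P), v)) = 0 := by
    ext t <;> simp [rayField]
  rw [rayMap, this, map_zero, sub_zero]

/-- Paths with constant `rayMap` are integral curves. The second component is extended to a
function on `ℝ` in order to speak of its derivative. -/
lemma rayMap_eq_const [CompleteSpace P] [CompleteSpace E] (hF : ContDiff ℝ 1 F)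
    {w : C(unitInterval, P × E)} {h : P} {c : E}
    (hw : rayMap hF w = ContinuousMap.const unitInterval (h, c)) :
    (∀ t, (w t).1 = h) ∧ ∃ v : ℝ → E, (∀ t : unitInterval, v t = (w t).2) ∧
      ∀ t : unitInterval, HasDerivAt v (F (w t).2 h) t := by
  set H : C(P × E, P × E) := ⟨rayField F, continuous_rayField hF⟩ with hH
  have hint (t : unitInterval) : w t - primitive (H.comp w) t = (h, c) :=
    congrArg (fun q : C(unitInterval, P × E) => q t) hw
  have hfst (t : unitInterval) : (w t).1 = h := by
    have h1 := congrArg Prod.fst (hint t)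
    have h2 : (primitive (H.comp w) t).1 = 0 := by
      refine (map_primitive (ContinuousLinearMap.fst ℝ P E) _ t).trans ?_
      exact congrArg (fun q : C(unitInterval, P) => q t) (map_zero primitive)
    simpa [h2] using h1
  let f : C(unitInterval, E) := ⟨fun t => F (w t).2 h, by
    have := hF.continuous
    fun_prop⟩
  refine ⟨hfst, fun s => c + ∫ t in (0 : ℝ)..s, IccExtend zero_le_one f t, fun t => ?_,
    fun t => ?_⟩
  · have h1 := congrArg Prod.snd (hint t)
    have h2 : (primitive (H.comp w) t).2 = primitive f t := by
      refine (map_primitive (ContinuousLinearMap.snd ℝ P E) _ t).trans ?_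
      refine congrArg (fun q : C(unitInterval, E) => primitive q t) ?_
      ext s
      simp [H, rayField, hfst, f]
    rw [Prod.snd_sub, h2] at h1
    exact ((sub_eq_iff_eq_add.1 h1).trans rfl).symm
  · have := (hasDerivAt_integral_IccExtend f t).const_add c
    rwa [IccExtend_of_mem _ _ t.2] at this

/-- The candidate for the derivative of a solution along a ray with respect to the direction of
the ray: a solution `u` of `Du = F(u)` satisfies `∂ₕ (u (t h)) k = t F(u (t h)) k`. -/
def rayVariation (hF : ContDiff ℝ 1 F) (w : C(unitInterval, P × E)) (k : P) :
    C(unitInterval, P × E) :=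
  ⟨fun t => (k, (t : ℝ) • F (w t).2 k), by
    have := hF.continuous
    fun_prop⟩

/-- The integrability condition says that `rayVariation` solves the linearized equation. -/
lemma rayMapDeriv_rayVariation [CompleteSpace P] [CompleteSpace E] (hF : ContDiff ℝ 1 F)
    {w : C(unitInterval, P × E)} {h k : P} {c : E}
    (hw : rayMap hF w = ContinuousMap.const unitInterval (h, c))
    (hsymm : ∀ t, fderiv ℝ F (w t).2 (F (w t).2 k) h = fderiv ℝ F (w t).2 (F (w t).2 h) k) :
    rayMapDeriv hF w (rayVariation hF w k) = ContinuousMap.const unitInterval (k, 0) := by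
  obtain ⟨hfst, v, hv, hv'⟩ := rayMap_eq_const hF hw
  set z := pointwiseApply ((⟨rayFieldDeriv F, continuous_rayFieldDeriv hF⟩ :
      C(P × E, P × E →L[ℝ] P × E)).comp w) (rayVariation hF w k) with hz
  -- by the integrability condition, the integrand of the linearized equation is the derivative
  -- of `τ F(v τ) k`
  have hder (τ : unitInterval) : HasDerivAt (fun τ : ℝ => ((0 : P), τ • F (v τ) k)) (z τ) τ := by
    have hFd : HasFDerivAt F (fderiv ℝ F (w τ).2) (v τ) := by
      rw [hv]
      exact (hF.differentiable one_ne_zero).differentiableAt.hasFDerivAt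
    have h2 := (hFd.comp_hasDerivAt (τ : ℝ) (hv' τ)).clm_apply (hasDerivAt_const (τ : ℝ) k)
    have h3 := (hasDerivAt_const (τ : ℝ) (0 : P)).prodMk ((hasDerivAt_id (τ : ℝ)).smul h2)
    refine h3.congr_deriv ?_
    have h4 : z τ = rayFieldDeriv F (w τ) (k, (τ : ℝ) • F (w τ).2 k) := rfl
    rw [h4, rayFieldDeriv_apply, hfst]
    simp [hsymm, hv, add_comm]
  ext1 s
  have h1 := primitive_eq_of_hasDerivAt hder s
  rw [rayMapDeriv, sub_apply, ContinuousMap.sub_apply, ContinuousLinearMap.comp_apply, ← hz, h1]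
  ext <;> simp [rayVariation, hv]

end Ray

/-! ### Analyticity and solvability of total differential equations -/

section TotalDifferential

variable {P E : Type*} [NormedAddCommGroup P] [NormedSpace ℝ P] [CompleteSpace P]
  [NormedAddCommGroup E] [NormedSpace ℝ E] [FiniteDimensional ℝ E] {F : E → P →L[ℝ] E}

/-- A solution of a total differential equation `Du = F(u)` is real analytic wherever `F` is. -/
theorem analyticAt_of_eventually_hasFDerivAt {u : P → E} {x₀ : P} (hF : AnalyticAt ℝ F (u x₀))
    (hu : ∀ᶠ x in 𝓝 x₀, HasFDerivAt u (F (u x)) x) : AnalyticAt ℝ u x₀ := by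
  have : CompleteSpace E := FiniteDimensional.complete ℝ E
  obtain ⟨F₁, hF₁, hFF⟩ := exists_contDiff_eventuallyEq (hF.contDiffAt (n := 1))
  have hF₁a : AnalyticAt ℝ F₁ (u x₀) := hF.congr hFF.symm
  have hcont : ContinuousAt u x₀ := hu.self_of_nhds.continuousAt
  set a : C(unitInterval, P × E) := ContinuousMap.const unitInterval ((0 : P), u x₀) with ha
  obtain ⟨e, he⟩ := isUnit_rayMapDeriv_const hF₁ (P := P) (u x₀)
  have hd : HasFDerivAt (rayMap hF₁) (ContinuousLinearEquiv.unitsEquiv ℝ _ e :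
      C(unitInterval, P × E) →L[ℝ] C(unitInterval, P × E)) a := by
    convert! hasFDerivAt_rayMap hF₁ a
  have hsm : ContDiffAt ℝ ω (rayMap hF₁) a := (analyticAt_rayMap hF₁ hF₁a).contDiffAt
  have hfix : a = rayMap hF₁ a := (rayMap_const hF₁ _).symm
  have hω : (ω : WithTop ℕ∞) ≠ 0 := by simp
  -- the local inverse is analytic at `rayMap hF₁ a`, which is `a`, but not by definition
  set g := hsm.localInverse hd hω
  have hg : ContDiffAt ℝ ω g a := by
    have key : ∀ b, b = rayMap hF₁ a → ContDiffAt ℝ ω g b := by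
      rintro _ rfl
      exact hsm.to_localInverse hd hω
    exact key a hfix
  have hleft : ∀ᶠ w in 𝓝 a, g (rayMap hF₁ w) = w :=
    (hsm.hasStrictFDerivAt' hd hω).eventually_left_inverse
  obtain ⟨ε, hε, hleft'⟩ := Metric.eventually_nhds_iff_ball.1 hleft
  obtain ⟨δ, hδ, hball⟩ := Metric.eventually_nhds_iff_ball.1 ((hu.and (hcont.eventually hFF)).and
    (hcont.eventually (Metric.ball_mem_nhds _ (half_pos hε))))
  -- the path of values of `u` on the segment from `x₀` to `x` is recovered by the local inverse
  have hkey : ∀ x ∈ Metric.ball x₀ (min δ (ε / 2)),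
      u x = (g (ContinuousMap.const unitInterval (x - x₀, u x₀)) 1).2 := by
    intro x hx
    have hxδ : ‖x - x₀‖ < δ := by
      rw [← dist_eq_norm]; exact (Metric.mem_ball.1 hx).trans_le (min_le_left _ _)
    have hxε : ‖x - x₀‖ < ε / 2 := by
      rw [← dist_eq_norm]; exact (Metric.mem_ball.1 hx).trans_le (min_le_right _ _)
    have hmem (t : unitInterval) : x₀ + (t : ℝ) • (x - x₀) ∈ Metric.ball x₀ δ := by
      rw [Metric.mem_ball, dist_eq_norm, add_sub_cancel_left, norm_smul, Real.norm_eq_abs,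
        abs_of_nonneg t.2.1]
      exact (mul_le_of_le_one_left (norm_nonneg _) t.2.2).trans_lt hxδ
    have hder (t : unitInterval) : HasDerivAt (fun s : ℝ => u (x₀ + s • (x - x₀)))
        (F₁ (u (x₀ + (t : ℝ) • (x - x₀))) (x - x₀)) t := by
      have h1 : HasDerivAt (fun s : ℝ => x₀ + s • (x - x₀)) (x - x₀) t := by
        simpa using ((hasDerivAt_id (t : ℝ)).smul_const (x - x₀)).const_add x₀
      rw [(hball _ (hmem t)).1.2]
      exact (hball _ (hmem t)).1.1.comp_hasDerivAt (t : ℝ) h1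
    let w : C(unitInterval, P × E) := ⟨fun t => (x - x₀, u (x₀ + (t : ℝ) • (x - x₀))), by
      refine continuous_const.prodMk (continuous_iff_continuousAt.2 fun t => ?_)
      exact (hder t).continuousAt.comp (f := fun t : unitInterval => (t : ℝ))
        continuous_subtype_val.continuousAt⟩
    have hw : w ∈ Metric.ball a ε := by
      rw [Metric.mem_ball]
      refine lt_of_le_of_lt ((ContinuousMap.dist_le (half_pos hε).le).2 fun t => ?_)
        (half_lt_self hε)
      rw [Prod.dist_eq]
      refine max_le ?_ (hball _ (hmem t)).2.le
      simpa [w, a] using hxε.le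
    have hrw : rayMap hF₁ w = ContinuousMap.const unitInterval (x - x₀, u x₀) := by
      ext1 t
      have := primitive_eq_of_hasDerivAt
        (v := (⟨rayField F₁, continuous_rayField hF₁⟩ : C(P × E, P × E)).comp w)
        (f := fun s : ℝ => ((0 : P), u (x₀ + s • (x - x₀))))
        (fun t => (hasDerivAt_const (t : ℝ) (0 : P)).prodMk (hder t)) t
      rw [rayMap, ContinuousMap.sub_apply, this]
      ext <;> simp [w]
    have hfin := hleft' w hw
    rw [hrw] at hfin
    rw [hfin]
    simp [w]
  have han : AnalyticAt ℝ (fun x : P =>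
      (g (ContinuousMap.const unitInterval (x - x₀, u x₀)) 1).2) x₀ := by
    have h1 : ContDiffAt ℝ ω (fun x : P => ContinuousMap.const unitInterval (x - x₀, u x₀)) x₀ :=
      (ContinuousLinearMap.const ℝ unitInterval :
        P × E →L[ℝ] C(unitInterval, P × E)).contDiff.contDiffAt.comp x₀
        ((contDiffAt_id.sub contDiffAt_const).prodMk contDiffAt_const)
    have h2 : ContDiffAt ℝ ω g (ContinuousMap.const unitInterval (x₀ - x₀, u x₀)) := by
      rwa [sub_self]
    have h3 := h2.comp x₀ h1
    exact ((ContinuousMap.evalCLM ℝ (1 : unitInterval)).contDiff.contDiffAt.comp x₀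
      h3).snd.analyticAt
  refine han.congr ?_
  filter_upwards [Metric.ball_mem_nhds x₀ (lt_min hδ (half_pos hε))] with x hx
  exact (hkey x hx).symm

/-- **Frobenius theorem** for total differential equations: if the integrability condition holds,
then `Du = F(u)` has a local solution with arbitrary initial value. -/
theorem exists_eventually_hasFDerivAt {c : E} (hF : ContDiffAt ℝ 1 F c)
    (hsymm : ∀ᶠ v in 𝓝 c, ∀ h k, fderiv ℝ F v (F v k) h = fderiv ℝ F v (F v h) k) (x₀ : P) :
    ∃ u : P → E, u x₀ = c ∧ ∀ᶠ x in 𝓝 x₀, HasFDerivAt u (F (u x)) x := by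
  have : CompleteSpace E := FiniteDimensional.complete ℝ E
  obtain ⟨F₁, hF₁, hFF⟩ := exists_contDiff_eventuallyEq hF
  set a : C(unitInterval, P × E) := ContinuousMap.const unitInterval ((0 : P), c) with ha
  obtain ⟨e, he⟩ := isUnit_rayMapDeriv_const hF₁ (P := P) c
  have hd : HasFDerivAt (rayMap hF₁) (ContinuousLinearEquiv.unitsEquiv ℝ _ e :
      C(unitInterval, P × E) →L[ℝ] C(unitInterval, P × E)) a := by
    convert! hasFDerivAt_rayMap hF₁ a
  have hsm : ContDiffAt ℝ 1 (rayMap hF₁) a := (contDiff_rayMap hF₁).contDiffAt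
  have hfix : a = rayMap hF₁ a := (rayMap_const hF₁ _).symm
  set g := hsm.localInverse hd one_ne_zero
  have hg : ContDiffAt ℝ 1 g a := by
    have key : ∀ b, b = rayMap hF₁ a → ContDiffAt ℝ 1 g b := by
      rintro _ rfl
      exact hsm.to_localInverse hd one_ne_zero
    exact key a hfix
  have hga : g a = a := by
    have key : ∀ b, b = rayMap hF₁ a → g b = a := by
      rintro _ rfl
      exact hsm.localInverse_apply_image hd one_ne_zero
    exact key a hfix
  have hright : ∀ᶠ w in 𝓝 a, rayMap hF₁ (g w) = w := by
    have key : ∀ b, b = rayMap hF₁ a → ∀ᶠ w in 𝓝 b, rayMap hF₁ (g w) = w := by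
      rintro _ rfl
      exact (hsm.hasStrictFDerivAt' hd one_ne_zero).eventually_right_inverse
    exact key a hfix
  -- invertibility of the derivative persists near `a`; it gives uniqueness for the linearized
  -- equation below
  have hunit : ∀ᶠ w in 𝓝 a, rayMapDeriv hF₁ (g w) ∈ range ((↑) :
      (C(unitInterval, P × E) ≃L[ℝ] C(unitInterval, P × E)) →
        C(unitInterval, P × E) →L[ℝ] C(unitInterval, P × E)) := by
    have h1 : ContinuousAt (fun w => rayMapDeriv hF₁ (g w)) a :=
      (continuous_rayMapDeriv hF₁).continuousAt.comp hg.continuousAt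
    refine h1.preimage_mem_nhds (ContinuousLinearEquiv.isOpen.mem_nhds ?_)
    rw [hga]
    exact ⟨ContinuousLinearEquiv.unitsEquiv ℝ _ e, he⟩
  have hdiff : ∀ᶠ w in 𝓝 a, DifferentiableAt ℝ g w :=
    (hg.eventually (by simp)).mono fun w hw => hw.differentiableAt one_ne_zero
  obtain ⟨ε, hε, hball⟩ := Metric.eventually_nhds_iff_ball.1 (hFF.eventually_nhds.and hsymm)
  have hnear : ∀ᶠ w in 𝓝 a, ∀ t, (g w t).2 ∈ Metric.ball c ε := by
    have := hg.continuousAt.eventually (Metric.ball_mem_nhds (g a) hε)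
    filter_upwards [this] with w hw t
    rw [hga] at hw
    have h1 : dist (g w t) ((0 : P), c) < ε :=
      lt_of_le_of_lt (ContinuousMap.dist_apply_le_dist (g := a) t) hw
    exact (le_max_right _ _).trans_lt h1
  -- the solution is the end point of the path which solves the equation along the segment
  let κ : P → C(unitInterval, P × E) := fun x => ContinuousMap.const unitInterval (x - x₀, c)
  have hκ (x : P) : HasFDerivAt κ ((ContinuousLinearMap.const ℝ unitInterval :
      P × E →L[ℝ] C(unitInterval, P × E)).comp (ContinuousLinearMap.inl ℝ P E)) x := by
    have h1 : HasFDerivAt (fun x : P => (x - x₀, c)) (ContinuousLinearMap.inl ℝ P E) x :=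
      ((hasFDerivAt_id x).sub_const x₀).prodMk (hasFDerivAt_const c x)
    exact (ContinuousLinearMap.hasFDerivAt (ContinuousLinearMap.const ℝ unitInterval :
      P × E →L[ℝ] C(unitInterval, P × E))).comp x h1
  have hκa : κ x₀ = a := by simp [κ, a]
  refine ⟨fun x => (g (κ x) 1).2, by simp [hκa, hga, a], ?_⟩
  have hall := (hright.eventually_nhds.and (hunit.and (hdiff.and hnear)))
  rw [← hκa] at hall
  filter_upwards [(hκ x₀).continuousAt.eventually hall] with x ⟨hxr, hxu, hxd, hxn⟩
  set w := g (κ x) with hw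
  have hW : HasFDerivAt (fun x => g (κ x)) ((fderiv ℝ g (κ x)).comp _) x :=
    hxd.hasFDerivAt.comp x (hκ x)
  obtain ⟨hfst, -⟩ := rayMap_eq_const hF₁ hxr.self_of_nhds
  -- the derivative of `w` with respect to its direction, by uniqueness for the linearized equation
  have hvar (k : P) (t : unitInterval) :
      (fderiv ℝ g (κ x) (ContinuousMap.const unitInterval (k, 0)) t).2 =
        (t : ℝ) • F₁ (w t).2 k := by
    have hz : rayMapDeriv hF₁ w (fderiv ℝ g (κ x) (ContinuousMap.const unitInterval (k, 0))) =
        ContinuousMap.const unitInterval (k, 0) := by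
      have h1 := (hasFDerivAt_rayMap hF₁ w).comp x hW
      have h2 : (rayMap hF₁ ∘ fun x => g (κ x)) =ᶠ[𝓝 x] κ :=
        (hκ x).continuousAt.eventually hxr
      have h3 := h1.unique ((hκ x).congr_of_eventuallyEq h2)
      exact congrArg (fun q : P →L[ℝ] C(unitInterval, P × E) => q k) h3
    have hy := rayMapDeriv_rayVariation hF₁ hxr.self_of_nhds (k := k) fun s => by
      obtain ⟨hb, hs⟩ := hball _ (hxn s)
      have hs' := hs (x - x₀) k
      rwa [← EventuallyEq.fderiv_eq hb, ← hb.self_of_nhds] at hs'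
    have hzy : fderiv ℝ g (κ x) (ContinuousMap.const unitInterval (k, 0)) =
        rayVariation hF₁ w k := by
      obtain ⟨U, hU⟩ := hxu
      rw [← hU] at hz hy
      exact U.injective (hz.trans hy.symm)
    rw [hzy]
    rfl
  have hfin := ((ContinuousLinearMap.snd ℝ P E).comp
    (ContinuousMap.evalCLM ℝ (1 : unitInterval))).hasFDerivAt.comp x hW
  refine hfin.congr_fderiv ?_
  ext k
  refine (hvar k 1).trans ?_
  rw [← (hball _ (hxn 1)).1.self_of_nhds]
  simp [w]

omit [CompleteSpace P] [FiniteDimensional ℝ E] in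
/-- Solutions of smooth total differential equations are smooth. -/
lemma contDiffOn_of_hasFDerivAt {u : P → E} {U : Set P} {V : Set E} (hU : IsOpen U)
    (hF : ContDiffOn ℝ ∞ F V) (huV : MapsTo u U V) (hu : ∀ x ∈ U, HasFDerivAt u (F (u x)) x) :
    ContDiffOn ℝ ∞ u U := by
  rw [contDiffOn_infty]
  intro n
  induction n with
  | zero => exact contDiffOn_zero.2 fun x hx => (hu x hx).continuousAt.continuousWithinAt
  | succ n ih =>
    rw [Nat.cast_add, Nat.cast_one, contDiffOn_succ_iff_fderiv_of_isOpen hU]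
    refine ⟨fun x hx => (hu x hx).differentiableAt.differentiableWithinAt, by simp, ?_⟩
    exact ((hF.of_le (by exact_mod_cast le_top)).comp ih huV).congr fun x hx => (hu x hx).fderiv

end TotalDifferential

/-! ### Coordinate fields and Christoffel symbols -/

lemma pderiv_coord {φ : Plane → Plane} {x : Plane} (hφ : DifferentiableAt ℝ φ x) (i k : Fin 2) :
    pderiv i (fun y => φ y k) x = fderiv ℝ φ x (EuclideanSpace.single i 1) k := by
  have h := (EuclideanSpace.proj (𝕜 := ℝ) k : Plane →L[ℝ] ℝ).hasFDerivAt.comp x hφ.hasFDerivAt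
  exact congrArg (fun L : Plane →L[ℝ] ℝ => L (EuclideanSpace.single i 1)) h.fderiv

lemma contDiffAt_coord {n : WithTop ℕ∞} {x : Plane} (k : Fin 2) :
    ContDiffAt ℝ n (fun y : Plane => y k) x :=
  (EuclideanSpace.proj k : Plane →L[ℝ] ℝ).contDiff.contDiffAt

lemma contDiffAt_pderiv {m n : WithTop ℕ∞} {f : Plane → ℝ} {x : Plane} (hf : ContDiffAt ℝ n f x)
    (hmn : m + 1 ≤ n) (i : Fin 2) : ContDiffAt ℝ m (pderiv i f) x :=
  (hf.fderiv_right hmn).clm_apply contDiffAt_const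

lemma mdifferentiableAt_const_field (v x : Plane) :
    MDifferentiableAt (𝓡 2) (𝓡 2).tangent
      (fun y : Plane => (⟨y, v⟩ : TangentBundle (𝓡 2) Plane)) x :=
  ((contMDiff_vectorSpace_iff_contDiff (n := 1)).2 contDiff_const).mdifferentiable one_ne_zero x

section Charts

variable {M : Type*} [TopologicalSpace M] [ChartedSpace Plane M]
  {e e' : OpenPartialHomeomorph M Plane} {p : M}

lemma mdifferentiable_of_mem_maximalAtlas (he : e ∈ IsManifold.maximalAtlas (𝓡 2) ∞ M) :
    e.MDifferentiable (𝓡 2) (𝓡 2) :=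
  ⟨fun _ hx => ((contMDiffOn_of_mem_maximalAtlas he).mdifferentiableOn (by simp)) _ hx,
    fun _ hx => ((contMDiffOn_symm_of_mem_maximalAtlas he).mdifferentiableOn (by simp)) _ hx⟩

lemma mfderiv_coordField (he : e ∈ IsManifold.maximalAtlas (𝓡 2) ∞ M) (hp : p ∈ e.source)
    (j : Fin 2) :
    mfderiv (𝓡 2) (𝓡 2) e p (coordField e j p) = EuclideanSpace.single j (1 : ℝ) := by
  have hd := mdifferentiable_of_mem_maximalAtlas he
  obtain ⟨u, hu⟩ := hd.mfderiv_surjective hp (EuclideanSpace.single j (1 : ℝ))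
  have h1 : coordField e j p = u := by
    rw [coordField]
    erw [← hu]
    exact congrArg (fun L : TangentSpace (𝓡 2) p →L[ℝ] TangentSpace (𝓡 2) p => L u)
      (hd.symm_comp_deriv hp)
  rw [h1, hu]

lemma coordField_expand (he : e ∈ IsManifold.maximalAtlas (𝓡 2) ∞ M) (hp : p ∈ e.source)
    (v : TangentSpace (𝓡 2) p) :
    v = (show Plane from mfderiv (𝓡 2) (𝓡 2) e p v) 0 • coordField e 0 p +
      (show Plane from mfderiv (𝓡 2) (𝓡 2) e p v) 1 • coordField e 1 p := by
  apply (mdifferentiable_of_mem_maximalAtlas he).mfderiv_injective hp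
  rw [map_add, map_smul, map_smul, mfderiv_coordField he hp, mfderiv_coordField he hp]
  set w : Plane := mfderiv (𝓡 2) (𝓡 2) e p v
  change w = w 0 • EuclideanSpace.single 0 1 + w 1 • EuclideanSpace.single 1 1
  ext k
  change w k = w 0 * (EuclideanSpace.single 0 1 : Plane) k +
    w 1 * (EuclideanSpace.single 1 1 : Plane) k
  fin_cases k <;> simp

lemma eventually_coordField_eq (he : e ∈ IsManifold.maximalAtlas (𝓡 2) ∞ M) (hp : p ∈ e.source)
    (j : Fin 2) : coordField e j =ᶠ[𝓝 p] VectorField.mpullback (𝓡 2) (𝓡 2) e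
      (fun _ : Plane => (EuclideanSpace.single j (1 : ℝ) : Plane)) := by
  filter_upwards [e.open_source.mem_nhds hp] with q hq
  have hd := mdifferentiable_of_mem_maximalAtlas he
  have hinv : (mfderiv (𝓡 2) (𝓡 2) e q).IsInvertible := ⟨hd.mfderiv hq, rfl⟩
  exact (hinv.inverse_apply_eq.2 (mfderiv_coordField he hq j).symm).symm

lemma contDiffOn_transition (he : e ∈ IsManifold.maximalAtlas (𝓡 2) ∞ M)
    (he' : e' ∈ IsManifold.maximalAtlas (𝓡 2) ∞ M) :
    ContDiffOn ℝ ∞ (fun y => e' (e.symm y)) (e.symm.trans e').source := by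
  rw [← contMDiffOn_iff_contDiffOn]
  exact (contMDiffOn_of_mem_maximalAtlas he').comp ((contMDiffOn_symm_of_mem_maximalAtlas he).mono
    (by intro y hy; simp at hy; exact hy.1)) (by intro y hy; simp at hy; exact hy.2)

lemma contDiffAt_transition (he : e ∈ IsManifold.maximalAtlas (𝓡 2) ∞ M)
    (he' : e' ∈ IsManifold.maximalAtlas (𝓡 2) ∞ M) (hp : p ∈ e.source) (hp' : p ∈ e'.source) :
    ContDiffAt ℝ ∞ (fun y => e' (e.symm y)) (e p) :=
  (contDiffOn_transition he he').contDiffAt ((e.symm.trans e').open_source.mem_nhds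
    (by simp [hp, hp']))

lemma mfderiv_coordField_other (he : e ∈ IsManifold.maximalAtlas (𝓡 2) ∞ M)
    (he' : e' ∈ IsManifold.maximalAtlas (𝓡 2) ∞ M) (hp : p ∈ e.source) (hp' : p ∈ e'.source)
    (j k : Fin 2) :
    (show Plane from mfderiv (𝓡 2) (𝓡 2) e' p (coordField e j p)) k =
      pderiv j (fun y => e' (e.symm y) k) (e p) := by
  rw [pderiv_coord ((contDiffAt_transition he he' hp hp').differentiableAt (by simp))]
  have h1 : MDifferentiableAt (𝓡 2) (𝓡 2) e.symm (e p) :=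
    (mdifferentiable_of_mem_maximalAtlas he).mdifferentiableAt_symm (e.map_source hp)
  have h2 : MDifferentiableAt (𝓡 2) (𝓡 2) e' (e.symm (e p)) := by
    rw [e.left_inv hp]
    exact (mdifferentiable_of_mem_maximalAtlas he').mdifferentiableAt hp'
  have h3 := mfderiv_comp (e p) h2 h1
  rw [mfderiv_eq_fderiv] at h3
  have h4 := congrArg (fun L : Plane →L[ℝ] Plane => L (EuclideanSpace.single j 1) k) h3
  refine Eq.trans ?_ h4.symm
  have h5 : ∀ q, q = p → (show Plane from mfderiv (𝓡 2) (𝓡 2) e' p (coordField e j p)) k =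
      (show Plane from mfderiv (𝓡 2) (𝓡 2) e' q (coordField e j p)) k := by
    rintro _ rfl
    rfl
  exact h5 _ (e.left_inv hp)

variable [IsManifold (𝓡 2) ∞ M]

lemma mdifferentiableAt_coordField (he : e ∈ IsManifold.maximalAtlas (𝓡 2) ∞ M)
    (hp : p ∈ e.source) (j : Fin 2) :
    MDifferentiableAt (𝓡 2) (𝓡 2).tangent
      (fun x => (⟨x, coordField e j x⟩ : TangentBundle (𝓡 2) M)) p := by
  have hd := mdifferentiable_of_mem_maximalAtlas he
  have hinv : (mfderiv (𝓡 2) (𝓡 2) e p).IsInvertible := ⟨hd.mfderiv hp, rfl⟩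
  have hc : ContMDiffAt (𝓡 2) (𝓡 2) ∞ e p :=
    (contMDiffOn_of_mem_maximalAtlas he).contMDiffAt (e.open_source.mem_nhds hp)
  have h := MDifferentiableAt.mpullback_vectorField (n := ∞)
    (mdifferentiableAt_const_field (EuclideanSpace.single j (1 : ℝ)) (e p)) hc hinv ENat.LEInfty.out
  refine h.congr_of_eventuallyEq ?_
  filter_upwards [eventually_coordField_eq he hp j] with q hq
  rw [hq]

lemma mlieBracket_coordField (he : e ∈ IsManifold.maximalAtlas (𝓡 2) ∞ M)
    (hp : p ∈ e.source) (i j : Fin 2) :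
    VectorField.mlieBracket (𝓡 2) (coordField e i) (coordField e j) p = 0 := by
  have hc : ContMDiffAt (𝓡 2) (𝓡 2) ∞ e p :=
    (contMDiffOn_of_mem_maximalAtlas he).contMDiffAt (e.open_source.mem_nhds hp)
  have : IsManifold (𝓡 2) (minSmoothness ℝ 2) M := by
    rw [minSmoothness_of_isRCLikeNormedField]
    infer_instance
  have : IsManifold (𝓡 2) (minSmoothness ℝ 2) Plane := by
    rw [minSmoothness_of_isRCLikeNormedField]
    infer_instance
  have h1 := VectorField.mpullback_mlieBracket (n := ∞)
    (mdifferentiableAt_const_field (EuclideanSpace.single i (1 : ℝ)) (e p))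
    (mdifferentiableAt_const_field (EuclideanSpace.single j (1 : ℝ)) (e p)) hc
    (by rw [minSmoothness_of_isRCLikeNormedField]; exact ENat.LEInfty.out)
  have h2 := (eventually_coordField_eq he hp i).mlieBracket_vectorField
    (eventually_coordField_eq he hp j)
  rw [h2.self_of_nhds, ← h1]
  have h3 : VectorField.mlieBracket (𝓡 2)
      (fun _ : Plane => (EuclideanSpace.single i (1 : ℝ) : Plane))
      (fun _ : Plane => (EuclideanSpace.single j (1 : ℝ) : Plane)) = 0 := by
    refine VectorField.mlieBracketWithin_univ.symm.trans
      (VectorField.mlieBracketWithin_eq_lieBracketWithin.trans ?_)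
    ext1 x
    simp [VectorField.lieBracketWithin]
    rfl
  erw [h3]
  simp

lemma christoffel_apply (cov : Connection M) (hp : p ∈ e.source) (i j k : Fin 2) :
    christoffel cov e i j k (e p) = (show Plane from mfderiv (𝓡 2) (𝓡 2) e p
      (cov (coordField e j) p (coordField e i p))) k := by
  -- the tangent spaces at `e.symm (e p)` and `p` are different types, so the equality of the
  -- points is eliminated instead of rewritten
  have h : ∀ q, q = p → (show Plane from mfderiv (𝓡 2) (𝓡 2) e q
      (cov (coordField e j) q (coordField e i q))) k = (show Plane from mfderiv (𝓡 2) (𝓡 2) e p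
      (cov (coordField e j) p (coordField e i p))) k := by
    rintro _ rfl
    rfl
  exact h _ (e.left_inv hp)

lemma christoffel_symm {cov : Connection M} (htorsion : cov.torsion = 0)
    (he : e ∈ IsManifold.maximalAtlas (𝓡 2) ∞ M) {x : Plane} (hx : x ∈ e.target) (i j k : Fin 2) :
    christoffel cov e i j k x = christoffel cov e j i k x := by
  have hp := e.map_target hx
  rw [← e.right_inv hx, christoffel_apply cov hp, christoffel_apply cov hp]
  have h := cov.torsion_eq_zero_iff.1 htorsion (mdifferentiableAt_coordField he hp i)
    (mdifferentiableAt_coordField he hp j)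
  rw [mlieBracket_coordField he hp, sub_eq_zero] at h
  rw [h]

/-- **Transformation law** of the Christoffel symbols. -/
lemma christoffel_transform (cov : Connection M) (he : e ∈ IsManifold.maximalAtlas (𝓡 2) ∞ M)
    (he' : e' ∈ IsManifold.maximalAtlas (𝓡 2) ∞ M) (hp : p ∈ e.source) (hp' : p ∈ e'.source)
    (i j k : Fin 2) :
    ∑ m, christoffel cov e i j m (e p) * pderiv m (fun y => e' (e.symm y) k) (e p) =
      pderiv i (pderiv j (fun y => e' (e.symm y) k)) (e p) +
        ∑ a, ∑ b, pderiv i (fun y => e' (e.symm y) a) (e p) *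
          pderiv j (fun y => e' (e.symm y) b) (e p) * christoffel cov e' a b k (e' p) := by
  set J : Fin 2 → Fin 2 → Plane → ℝ := fun i a => pderiv i (fun y => e' (e.symm y) a) with hJ
  have hJd (i a : Fin 2) : DifferentiableAt ℝ (J i a) (e p) :=
    (contDiffAt_pderiv (m := 1) (n := ∞) ((contDiffAt_coord a).comp (e p)
      (contDiffAt_transition he he' hp hp'))
      (by rw [one_add_one_eq_two]; exact ENat.LEInfty.out) i).differentiableAt one_ne_zero
  have hd := mdifferentiable_of_mem_maximalAtlas he
  -- `∂_j` is expanded in the frame of `e'`, the Leibniz rule is applied, and the result is paired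
  -- with the differential of the `k`-th coordinate of `e'`
  have hexp : ∀ᶠ q in 𝓝 p, coordField e j q =
      J j 0 (e q) • coordField e' 0 q + J j 1 (e q) • coordField e' 1 q := by
    filter_upwards [e.open_source.mem_nhds hp, e'.open_source.mem_nhds hp'] with q hq hq'
    rw [coordField_expand he' hq' (coordField e j q), mfderiv_coordField_other he he' hq hq',
      mfderiv_coordField_other he he' hq hq']
  have hsc (a : Fin 2) : MDifferentiableAt (𝓡 2) 𝓘(ℝ, ℝ) (fun q => J j a (e q)) p :=
    (hJd j a).mdifferentiableAt.comp p (hd.mdifferentiableAt hp)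
  have hm (a : Fin 2) := mdifferentiableAt_coordField he' hp' a
  have hsm (a : Fin 2) := (hsc a).smul_section (hm a)
  have hcov : cov (coordField e j) p =
      cov ((fun q => J j 0 (e q)) • coordField e' 0 + (fun q => J j 1 (e q)) • coordField e' 1) p :=
    cov.isCovariantDerivativeOnUniv.congr_of_eventuallyEq (mdifferentiableAt_coordField he hp j)
      (mdifferentiableAt_add_section (hsm 0) (hsm 1)) univ_mem hexp
  rw [cov.isCovariantDerivativeOnUniv.add (hsm 0) (hsm 1),
    cov.isCovariantDerivativeOnUniv.leibniz (hm 0) (hsc 0),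
    cov.isCovariantDerivativeOnUniv.leibniz (hm 1) (hsc 1)] at hcov
  have hdir (a : Fin 2) : mvfderiv (𝓡 2) (fun q => J j a (e q)) p (coordField e i p) =
      pderiv i (J j a) (e p) := by
    have h1 := mfderiv_comp p (hJd j a).mdifferentiableAt (hd.mdifferentiableAt hp)
    have h2 : mvfderiv (𝓡 2) (fun q => J j a (e q)) p (coordField e i p) =
        mfderiv (𝓡 2) 𝓘(ℝ, ℝ) (J j a) (e p) (mfderiv (𝓡 2) (𝓡 2) e p (coordField e i p)) :=
      congrArg (fun L : TangentSpace (𝓡 2) p →L[ℝ] ℝ => L (coordField e i p)) h1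
    rw [h2, mfderiv_coordField he hp, mfderiv_eq_fderiv]
    rfl
  let ℓ : TangentSpace (𝓡 2) p →L[ℝ] ℝ :=
    (EuclideanSpace.proj k : Plane →L[ℝ] ℝ).comp
      (show TangentSpace (𝓡 2) p →L[ℝ] Plane from mfderiv (𝓡 2) (𝓡 2) e' p)
  have hℓ (m : Fin 2) : ℓ (coordField e m p) = J m k (e p) :=
    mfderiv_coordField_other he he' hp hp' m k
  have hℓ' (m : Fin 2) : ℓ (coordField e' m p) = (EuclideanSpace.single m (1 : ℝ) : Plane) k :=
    congrArg (fun v : Plane => v k) (mfderiv_coordField he' hp' m)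
  have hΓ' (a b : Fin 2) : ℓ (cov (coordField e' b) p (coordField e' a p)) =
      christoffel cov e' a b k (e' p) := (christoffel_apply cov hp' a b k).symm
  have hX (a : Fin 2) : ℓ (cov (coordField e' a) p (coordField e i p)) =
      J i 0 (e p) * christoffel cov e' 0 a k (e' p) +
        J i 1 (e p) * christoffel cov e' 1 a k (e' p) := by
    rw [coordField_expand he' hp' (coordField e i p), mfderiv_coordField_other he he' hp hp',
      mfderiv_coordField_other he he' hp hp', map_add, map_smul, map_smul, map_add, map_smul,
      map_smul, hΓ', hΓ']
    rfl
  have hL : ℓ (cov (coordField e j) p (coordField e i p)) =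
      christoffel cov e i j 0 (e p) * J 0 k (e p) +
        christoffel cov e i j 1 (e p) * J 1 k (e p) := by
    rw [coordField_expand he hp (cov (coordField e j) p (coordField e i p)),
      ← christoffel_apply cov hp, ← christoffel_apply cov hp, map_add, map_smul, map_smul, hℓ, hℓ]
    rfl
  have hR : ℓ (cov (coordField e j) p (coordField e i p)) =
      J j 0 (e p) * ℓ (cov (coordField e' 0) p (coordField e i p)) +
        pderiv i (J j 0) (e p) * ℓ (coordField e' 0 p) +
      (J j 1 (e p) * ℓ (cov (coordField e' 1) p (coordField e i p)) +
        pderiv i (J j 1) (e p) * ℓ (coordField e' 1 p)) := by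
    rw [hcov, ← hdir 0, ← hdir 1, add_apply, add_apply, add_apply, smul_apply, smul_apply,
      ContinuousLinearMap.smulRight_apply, ContinuousLinearMap.smulRight_apply, map_add, map_add,
      map_add, map_smul, map_smul, map_smul, map_smul]
    rfl
  rw [hL, hX, hX, hℓ', hℓ'] at hR
  simp only [Fin.sum_univ_two]
  change _ = pderiv i (J j k) (e p) + _
  rw [hR]
  fin_cases k <;> simp [J] <;> ring

end Charts

/-! ### Analyticity of transition maps -/

section Coordinates

variable {ι : Type*}

/-- The total differential `∑ᵢ dxⁱ Gᵢ` with values in `ℝ^ι`. -/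
def totalDifferential (G : Fin 2 → ι → (ι → ℝ) → ℝ) (v : ι → ℝ) : Plane →L[ℝ] (ι → ℝ) :=
  ∑ i, (EuclideanSpace.proj i : Plane →L[ℝ] ℝ).smulRight (fun a => G i a v)

lemma hasFDerivAt_totalDifferential {u : Plane → ι → ℝ} {G : Fin 2 → ι → (ι → ℝ) → ℝ} {x : Plane}
    (hd : ∀ a, DifferentiableAt ℝ (fun y => u y a) x)
    (hu : ∀ i a, pderiv i (fun y => u y a) x = G i a (u x)) :
    HasFDerivAt u (totalDifferential G (u x)) x := by
  rw [hasFDerivAt_pi']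
  intro a
  refine (hd a).hasFDerivAt.congr_fderiv ?_
  ext h
  have hh : h = ∑ i, h i • (EuclideanSpace.single i 1 : Plane) := by
    ext k; fin_cases k <;> simp
  conv_lhs => rw [hh, map_sum]
  simp only [map_smul]
  simp only [totalDifferential, ContinuousLinearMap.comp_apply, ContinuousLinearMap.proj_apply,
    sum_apply, Finset.sum_apply, ContinuousLinearMap.smulRight_apply]
  refine Finset.sum_congr rfl fun i _ => ?_
  exact congrArg (h i • ·) (hu i a)

lemma totalDifferential_apply (G : Fin 2 → ι → (ι → ℝ) → ℝ) (v : ι → ℝ) (h : Plane) (a : ι) :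
    totalDifferential G v h a = ∑ i, h i * G i a v := by
  simp [totalDifferential]

lemma pderiv_of_hasFDerivAt {u : Plane → ι → ℝ} {G : Fin 2 → ι → (ι → ℝ) → ℝ} {x : Plane}
    (hu : HasFDerivAt u (totalDifferential G (u x)) x) (i : Fin 2) (a : ι) :
    pderiv i (fun y => u y a) x = G i a (u x) := by
  have h := congrArg (fun L : Plane →L[ℝ] ℝ => L (EuclideanSpace.single i 1))
    (hasFDerivAt_pi'.1 hu a).fderiv
  refine h.trans ((totalDifferential_apply G (u x) _ a).trans ?_)
  fin_cases i <;> simp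

variable [Fintype ι]

lemma contDiffAt_totalDifferential {n : WithTop ℕ∞} {G : Fin 2 → ι → (ι → ℝ) → ℝ} {v : ι → ℝ}
    (hG : ∀ i a, ContDiffAt ℝ n (G i a) v) : ContDiffAt ℝ n (totalDifferential G) v := by
  refine ContDiffAt.sum fun i _ => ?_
  exact ((ContinuousLinearMap.smulRightL ℝ Plane (ι → ℝ)) _).contDiff.contDiffAt.comp v
    (contDiffAt_pi.2 fun a => hG i a)

/-- The integrability condition of a total differential equation in coordinates. -/
lemma fderiv_totalDifferential_symm {G : Fin 2 → ι → (ι → ℝ) → ℝ} {v : ι → ℝ}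
    (hG : ∀ i a, ContDiffAt ℝ 1 (G i a) v)
    (hsymm : ∀ i j a, fderiv ℝ (G i a) v (fun b => G j b v) =
      fderiv ℝ (G j a) v (fun b => G i b v)) (h k : Plane) :
    fderiv ℝ (totalDifferential G) v (totalDifferential G v k) h =
      fderiv ℝ (totalDifferential G) v (totalDifferential G v h) k := by
  have hd (i a) : DifferentiableAt ℝ (G i a) v := (hG i a).differentiableAt one_ne_zero
  have hF := ((contDiffAt_totalDifferential hG).differentiableAt one_ne_zero).hasFDerivAt
  have key (h : Plane) (w : ι → ℝ) (a : ι) : fderiv ℝ (totalDifferential G) v w h a =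
      ∑ i, h i * fderiv ℝ (G i a) v w := by
    have h1 := hasFDerivAt_pi'.1 (hF.clm_apply (hasFDerivAt_const h v)) a
    have h2 : HasFDerivAt (fun v => totalDifferential G v h a)
        (∑ i, h i • fderiv ℝ (G i a) v) v := by
      simp only [totalDifferential_apply]
      exact HasFDerivAt.fun_sum fun i _ => (hd i a).hasFDerivAt.const_mul (h i)
    have h3 := congrArg (fun L : (ι → ℝ) →L[ℝ] ℝ => L w) (h1.unique h2)
    simpa using h3
  have hw (k : Plane) : totalDifferential G v k = ∑ j, k j • fun b => G j b v := by
    ext a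
    simp [totalDifferential_apply]
  ext a
  rw [key, key, hw k, hw h]
  have hlin (i : Fin 2) (x y : ℝ) (f₀ f₁ : ι → ℝ) : fderiv ℝ (G i a) v (x • f₀ + y • f₁) =
      x * fderiv ℝ (G i a) v f₀ + y * fderiv ℝ (G i a) v f₁ := by
    rw [map_add, map_smul, map_smul, smul_eq_mul, smul_eq_mul]
  simp only [Fin.sum_univ_two, hlin, hsymm 1 0]
  ring

end Coordinates

section Transition

variable {M : Type*} [TopologicalSpace M] [ChartedSpace Plane M] [IsManifold (𝓡 2) ∞ M]
  {e e' : OpenPartialHomeomorph M Plane}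

/-- If the Christoffel symbols are real analytic in two charts, then so is the transition map: by
the transformation law, the transition map and its first partial derivatives solve a total
differential equation with real analytic right-hand side. -/
lemma analyticAt_transition (cov : Connection M) (he : e ∈ IsManifold.maximalAtlas (𝓡 2) ∞ M)
    (he' : e' ∈ IsManifold.maximalAtlas (𝓡 2) ∞ M)
    (hΓ : ∀ i j k, ContDiffOn ℝ ω (christoffel cov e i j k) e.target)
    (hΓ' : ∀ i j k, ContDiffOn ℝ ω (christoffel cov e' i j k) e'.target)
    {p : M} (hp : p ∈ e.source) (hp' : p ∈ e'.source) :
    ContDiffAt ℝ ω (fun y => e' (e.symm y)) (e p) := by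
  set φ : Plane → Plane := fun y => e' (e.symm y) with hφ
  -- the unknowns are the point `x`, its image `φ x` and the partial derivatives of `φ` at `x`;
  -- keeping `x` among the unknowns makes the system autonomous
  let ι := Fin 2 ⊕ Fin 2 ⊕ (Fin 2 × Fin 2)
  let u : Plane → ι → ℝ := fun x => Sum.elim (fun i => x i)
    (Sum.elim (fun k => φ x k) (fun q => pderiv q.1 (fun y => φ y q.2) x))
  let G : Fin 2 → ι → (ι → ℝ) → ℝ := fun i => Sum.elim (fun j _ => if i = j then 1 else 0)
    (Sum.elim (fun k v => v (Sum.inr (Sum.inr (i, k))))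
      (fun q v => ∑ m, christoffel cov e i q.1 m (WithLp.toLp 2 fun l => v (Sum.inl l)) *
          v (Sum.inr (Sum.inr (m, q.2))) -
        ∑ a, ∑ b, v (Sum.inr (Sum.inr (i, a))) * v (Sum.inr (Sum.inr (q.1, b))) *
          christoffel cov e' a b q.2 (WithLp.toLp 2 fun l => v (Sum.inr (Sum.inl l)))))
  have hG (i : Fin 2) (a : ι) : ContDiffAt ℝ ω (G i a) (u (e p)) := by
    have hv (b : ι) : ContDiffAt ℝ ω (fun v : ι → ℝ => v b) (u (e p)) :=
      (contDiff_apply ℝ ℝ b).contDiffAt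
    rcases a with j | k | ⟨j, k⟩
    · exact contDiffAt_const
    · exact hv _
    · refine ContDiffAt.sub (ContDiffAt.sum fun m _ => ContDiffAt.mul ?_ (hv _))
        (ContDiffAt.sum fun a _ => ContDiffAt.sum fun b _ => ((hv _).mul (hv _)).mul ?_)
      · refine ContDiffAt.comp (g := christoffel cov e i j m) _ ?_
          ((PiLp.contDiff_toLp (p := 2)).contDiffAt.comp _ (contDiffAt_pi.2 fun l => hv _))
        exact (hΓ i j m).contDiffAt (e.open_target.mem_nhds (e.map_source hp))
      · refine ContDiffAt.comp (g := christoffel cov e' a b k) _ ?_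
          ((PiLp.contDiff_toLp (p := 2)).contDiffAt.comp _ (contDiffAt_pi.2 fun l => hv _))
        refine (hΓ' a b k).contDiffAt (e'.open_target.mem_nhds ?_)
        change e' (e.symm (e p)) ∈ _
        rw [e.left_inv hp]
        exact e'.map_source hp'
  have hsource : (e.symm.trans e').source ∈ 𝓝 (e p) :=
    (e.symm.trans e').open_source.mem_nhds (by simp [hp, hp'])
  have hu : ∀ᶠ x in 𝓝 (e p), HasFDerivAt u (totalDifferential G (u x)) x := by
    filter_upwards [hsource] with x hx
    have hx1 : x ∈ e.target := by simpa using hx.1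
    have hx2 : e.symm x ∈ e'.source := by simpa using hx.2
    have hq := e.map_target hx1
    have hφx : ContDiffAt ℝ ∞ φ x := by
      have := contDiffAt_transition he he' hq hx2
      rwa [e.right_inv hx1] at this
    have hφk (k : Fin 2) : ContDiffAt ℝ ∞ (fun y => φ y k) x := (contDiffAt_coord k).comp x hφx
    refine hasFDerivAt_totalDifferential (fun a => ?_) (fun i a => ?_)
    · rcases a with j | k | ⟨j, k⟩
      · exact (contDiffAt_coord (n := 1) j).differentiableAt one_ne_zero
      · exact (hφk k).differentiableAt (by simp)
      · exact (contDiffAt_pderiv (m := 1) (hφk k)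
          (by rw [one_add_one_eq_two]; exact ENat.LEInfty.out) j).differentiableAt one_ne_zero
    · rcases a with j | k | ⟨j, k⟩
      · change pderiv i (fun y : Plane => y j) x = if i = j then 1 else 0
        rw [show pderiv i (fun y : Plane => y j) x = _ from pderiv_coord differentiableAt_id i j]
        simp [eq_comm]
      · rfl
      · have h := christoffel_transform cov he he' hq hx2 i j k
        rw [e.right_inv hx1] at h
        exact eq_sub_of_add_eq h.symm
  have han := analyticAt_of_eventually_hasFDerivAt (contDiffAt_totalDifferential hG).analyticAt hu
  have hcomp (k : Fin 2) : ContDiffAt ℝ ω (fun y => φ y k) (e p) :=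
    (contDiff_apply ℝ ℝ (Sum.inr (Sum.inl k) : ι)).contDiffAt.comp (e p) han.contDiffAt
  exact (contDiffAt_piLp (p := 2)).2 hcomp

/-- An atlas is real analytic if the Christoffel symbols are; the transition maps need not be
considered. -/
lemma isRealAnalyticAtlas_of_contDiffOn {cov : Connection M}
    {𝒜 : Set (OpenPartialHomeomorph M Plane)} (h𝒜 : IsCoordinateAtlas 𝒜)
    (hΓ : ∀ e ∈ 𝒜, ∀ i j k, ContDiffOn ℝ ω (christoffel cov e i j k) e.target) :
    IsRealAnalyticAtlas cov 𝒜 := by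
  have key : ∀ e ∈ 𝒜, ∀ e' ∈ 𝒜,
      ContDiffOn ℝ ω (fun y => e' (e.symm y)) (e.symm.trans e').source := by
    intro e he e' he' x hx
    have hx1 : x ∈ e.target := by simpa using hx.1
    have hx2 : e.symm x ∈ e'.source := by simpa using hx.2
    have := analyticAt_transition cov (h𝒜.1 he) (h𝒜.1 he') (hΓ e he) (hΓ e' he')
      (e.map_target hx1) hx2
    rw [e.right_inv hx1] at this
    exact this.contDiffWithinAt
  refine ⟨h𝒜, fun e he e' he' => ?_, fun e he i j k => ?_⟩
  · rw [contDiffGroupoid, mem_groupoid_of_pregroupoid]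
    refine ⟨?_, ?_⟩
    · simpa [contDiffPregroupoid, Function.comp_def] using key e he e' he'
    · simpa [contDiffPregroupoid, Function.comp_def] using key e' he' e he
  · intro x hx
    exact ((hΓ e he i j k).contDiffAt (e.open_target.mem_nhds hx)).analyticAt

end Transition

/-! ### The Levi-Civita connection in coordinates -/

section Koszul

variable {M : Type*} [TopologicalSpace M] [ChartedSpace Plane M] [IsManifold (𝓡 2) ∞ M]
  {e : OpenPartialHomeomorph M Plane} {cov : Connection M}

/-- **Koszul formula**: a torsion-free connection is determined by a parallel metric. -/
lemma koszul_formula (htorsion : cov.torsion = 0) (he : e ∈ IsManifold.maximalAtlas (𝓡 2) ∞ M)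
    {g : Plane → Matrix (Fin 2) (Fin 2) ℝ} (hg : IsMetricInChart cov e g) {x : Plane}
    (hx : x ∈ e.target) (hsymm : (g x).IsSymm) (hdet : (g x).det ≠ 0) (i j k : Fin 2) :
    christoffel cov e i j k x = (2 * (g x).det)⁻¹ * ∑ l, (g x).adjugate l k *
      (pderiv i (fun y => g y j l) x + pderiv j (fun y => g y i l) x -
        pderiv l (fun y => g y i j) x) := by
  have hs (i j k) := christoffel_symm htorsion he hx i j k
  have h10 : g x 1 0 = g x 0 1 := hsymm.apply 0 1
  have hd : (g x).det = g x 0 0 * g x 1 1 - g x 0 1 * g x 0 1 := by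
    rw [Matrix.det_fin_two, h10]
  rw [eq_inv_mul_iff_mul_eq₀ (mul_ne_zero two_ne_zero hdet), hd]
  simp only [hg x hx, Fin.sum_univ_two, Matrix.adjugate_fin_two]
  fin_cases i <;> fin_cases j <;> fin_cases k <;> simp [h10, hs 1 0] <;> ring

/-- The Koszul formula loses one derivative, which does no harm if `n` is `∞` or `ω`. -/
lemma contDiffOn_christoffel {n : WithTop ℕ∞} (hn : n + 1 ≤ n) (htorsion : cov.torsion = 0)
    (he : e ∈ IsManifold.maximalAtlas (𝓡 2) ∞ M) {g : Plane → Matrix (Fin 2) (Fin 2) ℝ}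
    (hg : IsMetricInChart cov e g) (hgd : ∀ i j, ContDiffOn ℝ n (fun x => g x i j) e.target)
    (hsymm : ∀ x ∈ e.target, (g x).IsSymm ∧ (g x).det ≠ 0) (i j k : Fin 2) :
    ContDiffOn ℝ n (christoffel cov e i j k) e.target := by
  have hga (x) (hx : x ∈ e.target) (i j) : ContDiffAt ℝ n (fun x => g x i j) x :=
    (hgd i j).contDiffAt (e.open_target.mem_nhds hx)
  refine ContDiffOn.congr (fun x hx => ContDiffAt.contDiffWithinAt ?_) fun x hx =>
    koszul_formula htorsion he hg hx (hsymm x hx).1 (hsymm x hx).2 i j k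
  refine ContDiffAt.mul (ContDiffAt.inv ?_ ?_) (ContDiffAt.sum fun l _ => ContDiffAt.mul ?_ ?_)
  · simp only [Matrix.det_fin_two]
    exact contDiffAt_const.mul (((hga x hx _ _).mul (hga x hx _ _)).sub
      ((hga x hx _ _).mul (hga x hx _ _)))
  · exact mul_ne_zero two_ne_zero (hsymm x hx).2
  · simp only [Matrix.adjugate_fin_two]
    fin_cases l <;> fin_cases k <;> simp
    · exact hga x hx _ _
    · exact (hga x hx _ _).neg
    · exact (hga x hx _ _).neg
    · exact hga x hx _ _
  · exact ((contDiffAt_pderiv (hga x hx _ _) hn _).add (contDiffAt_pderiv (hga x hx _ _) hn _)).sub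
      (contDiffAt_pderiv (hga x hx _ _) hn _)

end Koszul

/-! ### Atlases with analytic Christoffel symbols -/

section Atlases

variable {M : Type*} [TopologicalSpace M] [ChartedSpace Plane M] [IsManifold (𝓡 2) ∞ M]
  {cov : Connection M} {𝒜 : Set (OpenPartialHomeomorph M Plane)}

lemma IsTypeAAtlas.isRealAnalyticAtlas (h : IsTypeAAtlas cov 𝒜) : IsRealAnalyticAtlas cov 𝒜 := by
  refine isRealAnalyticAtlas_of_contDiffOn h.1 fun e he i j k => ?_
  obtain ⟨C, hC⟩ := h.2 e he
  exact (contDiffOn_const (c := C i j k)).congr fun x hx => hC x hx i j k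

lemma IsTypeBAtlas.isRealAnalyticAtlas (h : IsTypeBAtlas cov 𝒜) : IsRealAnalyticAtlas cov 𝒜 := by
  refine isRealAnalyticAtlas_of_contDiffOn h.1 fun e he i j k => ?_
  obtain ⟨C, hC⟩ := h.2 e he
  refine ContDiffOn.congr (fun x hx => ?_) fun x hx => (hC x hx).2 i j k
  exact (((contDiffAt_coord 0).inv (hC x hx).1.ne').mul contDiffAt_const).contDiffWithinAt

lemma IsTypeCAtlas.isRealAnalyticAtlas (htorsion : cov.torsion = 0) (h : IsTypeCAtlas ω cov 𝒜) :
    IsRealAnalyticAtlas cov 𝒜 := by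
  refine isRealAnalyticAtlas_of_contDiffOn h.1 fun e he i j k => ?_
  obtain ⟨g, K, hg, hsymm, hmetric, -⟩ := h.2 e he
  exact contDiffOn_christoffel le_top htorsion (h.1.1 he) hmetric hg hsymm i j k

lemma flatMetric_regular {n : WithTop ℕ∞} (x : Plane) :
    (∀ i j, ContDiffAt ℝ n (fun y => flatMetric y i j) x) ∧
      (flatMetric x).IsSymm ∧ (flatMetric x).det ≠ 0 :=
  ⟨fun _ _ => contDiffAt_const, Matrix.isSymm_one, by simp [flatMetric]⟩

lemma sphereMetric_regular {n : WithTop ℕ∞} (x : Plane) :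
    (∀ i j, ContDiffAt ℝ n (fun y => sphereMetric y i j) x) ∧
      (sphereMetric x).IsSymm ∧ (sphereMetric x).det ≠ 0 := by
  have h : (1 + (x 0 ^ 2 + x 1 ^ 2)) ^ 2 ≠ 0 := by positivity
  refine ⟨fun i j => ?_, Matrix.isSymm_one.smul _, ?_⟩
  · exact (contDiffAt_const.div ((contDiffAt_const.add (((contDiffAt_coord 0).pow 2).add
      ((contDiffAt_coord 1).pow 2))).pow 2) h).mul contDiffAt_const
  · rw [sphereMetric, Matrix.det_smul, Matrix.det_one, mul_one]
    positivity

lemma halfPlaneMetric_regular {n : WithTop ℕ∞} {ε : ℝ} (hε : ε ≠ 0) {x : Plane} (hx : 0 < x 0) :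
    (∀ i j, ContDiffAt ℝ n (fun y => halfPlaneMetric ε y i j) x) ∧
      (halfPlaneMetric ε x).IsSymm ∧ (halfPlaneMetric ε x).det ≠ 0 := by
  have h : x 0 ^ 2 ≠ 0 := by positivity
  refine ⟨fun i j => ?_, ?_, ?_⟩
  · exact (((contDiffAt_coord 0).pow 2).inv h).mul contDiffAt_const
  · refine Matrix.IsSymm.smul ?_ _
    ext i j
    fin_cases i <;> fin_cases j <;> rfl
  · rw [halfPlaneMetric, Matrix.det_smul, Matrix.det_fin_two_of]
    simp [hε, hx.ne']

lemma IsTypeCModelAtlas.isRealAnalyticAtlas (htorsion : cov.torsion = 0)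
    (h : IsTypeCModelAtlas cov 𝒜) : IsRealAnalyticAtlas cov 𝒜 := by
  refine isRealAnalyticAtlas_of_contDiffOn h.1 fun e he i j k => ?_
  have key {g : Plane → Matrix (Fin 2) (Fin 2) ℝ} (hg : IsMetricInChart cov e g)
      (hreg : ∀ x ∈ e.target, (∀ i j, ContDiffAt ℝ ω (fun y => g y i j) x) ∧
        (g x).IsSymm ∧ (g x).det ≠ 0) : ContDiffOn ℝ ω (christoffel cov e i j k) e.target :=
    contDiffOn_christoffel le_top htorsion (h.1.1 he) hg
      (fun i j x hx => ((hreg x hx).1 i j).contDiffWithinAt) (fun x hx => (hreg x hx).2) i j k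
  rcases h.2 e he with hg | hg | ⟨hpos, hg⟩ | ⟨hpos, hg⟩
  · exact key hg fun x _ => flatMetric_regular x
  · exact key hg fun x _ => sphereMetric_regular x
  · exact key hg fun x hx => halfPlaneMetric_regular one_ne_zero (hpos x hx)
  · exact key hg fun x hx => halfPlaneMetric_regular (by norm_num) (hpos x hx)

end Atlases

/-! ### Partial derivatives -/

section PartialDerivatives

variable {f h : Plane → ℝ} {x : Plane}

lemma pderiv_add (i : Fin 2) (hf : DifferentiableAt ℝ f x) (hh : DifferentiableAt ℝ h x) :
    pderiv i (fun y => f y + h y) x = pderiv i f x + pderiv i h x := by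
  simp only [pderiv, fderiv_fun_add hf hh, add_apply]

lemma pderiv_sub (i : Fin 2) (hf : DifferentiableAt ℝ f x) (hh : DifferentiableAt ℝ h x) :
    pderiv i (fun y => f y - h y) x = pderiv i f x - pderiv i h x := by
  simp only [pderiv, fderiv_fun_sub hf hh, sub_apply]

lemma pderiv_mul (i : Fin 2) (hf : DifferentiableAt ℝ f x) (hh : DifferentiableAt ℝ h x) :
    pderiv i (fun y => f y * h y) x = pderiv i f x * h x + f x * pderiv i h x := by
  simp only [pderiv, fderiv_fun_mul hf hh, add_apply, smul_apply, smul_eq_mul]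
  ring

lemma pderiv_const_mul (i : Fin 2) (c : ℝ) (hf : DifferentiableAt ℝ f x) :
    pderiv i (fun y => c * f y) x = c * pderiv i f x := by
  simp only [pderiv, fderiv_const_mul hf, smul_apply, smul_eq_mul]

lemma pderiv_inv (i : Fin 2) (hf : DifferentiableAt ℝ f x) (h0 : f x ≠ 0) :
    pderiv i (fun y => (f y)⁻¹) x = -(f x ^ 2)⁻¹ * pderiv i f x := by
  have := (hasDerivAt_inv h0).comp_hasFDerivAt x hf.hasFDerivAt
  exact congrArg (fun L : Plane →L[ℝ] ℝ => L (EuclideanSpace.single i 1)) this.fderiv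

lemma pderiv_congr (i : Fin 2) (hfh : f =ᶠ[𝓝 x] h) : pderiv i f x = pderiv i h x := by
  rw [pderiv, pderiv, hfh.fderiv_eq]

lemma pderiv_comm (hf : ContDiffAt ℝ ∞ f x) (i j : Fin 2) :
    pderiv i (pderiv j f) x = pderiv j (pderiv i f) x := by
  have hd : DifferentiableAt ℝ (fderiv ℝ f) x :=
    (hf.fderiv_right (m := 1) (by rw [one_add_one_eq_two]; exact ENat.LEInfty.out)).differentiableAt
      one_ne_zero
  have key (i j : Fin 2) : pderiv i (pderiv j f) x =
      fderiv ℝ (fderiv ℝ f) x (EuclideanSpace.single i 1) (EuclideanSpace.single j 1) := by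
    have := hd.hasFDerivAt.clm_apply (hasFDerivAt_const (EuclideanSpace.single j (1 : ℝ) : Plane) x)
    refine (congrArg (fun L : Plane →L[ℝ] ℝ => L (EuclideanSpace.single i 1)) this.fderiv).trans ?_
    simp
  rw [key, key]
  exact hf.isSymmSndFDerivAt (by
    rw [minSmoothness_of_isRCLikeNormedField]; exact ENat.LEInfty.out) _ _

lemma fderiv_apply_eq_sum (f : Plane → ℝ) (x h : Plane) :
    fderiv ℝ f x h = ∑ i, h i * pderiv i f x := by
  have hh : h = ∑ i, h i • (EuclideanSpace.single i 1 : Plane) := by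
    ext k; fin_cases k <;> simp
  conv_lhs => rw [hh, map_sum]
  simp [pderiv]

lemma eventually_eq_of_pderiv_eq_zero {x₀ : Plane} (hd : ∀ᶠ x in 𝓝 x₀, DifferentiableAt ℝ f x)
    (hz : ∀ᶠ x in 𝓝 x₀, ∀ i, pderiv i f x = 0) : ∀ᶠ x in 𝓝 x₀, f x = f x₀ := by
  obtain ⟨ε, hε, hball⟩ := Metric.eventually_nhds_iff_ball.1 (hd.and hz)
  filter_upwards [Metric.ball_mem_nhds x₀ hε] with x hx
  refine (convex_ball x₀ ε).is_const_of_fderivWithin_eq_zero (𝕜 := ℝ)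
    (fun y hy => (hball y hy).1.differentiableWithinAt) (fun y hy => ?_) hx
    (Metric.mem_ball_self hε)
  rw [fderivWithin_of_isOpen Metric.isOpen_ball hy]
  ext h
  rw [fderiv_apply_eq_sum]
  simp [(hball y hy).2]

end PartialDerivatives

/-! ### Metrics of constant curvature -/

/-- A parallel metric `g` of constant Gauss curvature `K` for the smooth torsion-free connection on
the open set `U` of the plane with Christoffel symbols `Γ`. -/
structure IsConstCurvMetric (Γ : Fin 2 → Fin 2 → Fin 2 → Plane → ℝ)
    (g : Plane → Matrix (Fin 2) (Fin 2) ℝ) (K : ℝ) (U : Set Plane) : Prop where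
  isOpen : IsOpen U
  contDiffOn_christoffel : ∀ i j k, ContDiffOn ℝ ∞ (Γ i j k) U
  christoffel_symm : ∀ x ∈ U, ∀ i j k, Γ i j k x = Γ j i k x
  contDiffOn_metric : ∀ i j, ContDiffOn ℝ ∞ (fun x => g x i j) U
  metric_symm : ∀ x ∈ U, (g x).IsSymm
  det_ne_zero : ∀ x ∈ U, (g x).det ≠ 0
  parallel : ∀ x ∈ U, ∀ l i j, pderiv l (fun y => g y i j) x =
    ∑ m, (Γ l i m x * g x m j + Γ l j m x * g x i m)
  curvature : ∀ x ∈ U, ∑ l, (pderiv 0 (Γ 1 1 l) x - pderiv 1 (Γ 0 1 l) x +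
    ∑ m, (Γ 0 m l x * Γ 1 1 m x - Γ 1 m l x * Γ 0 1 m x)) * g x l 0 = K * (g x).det

namespace IsConstCurvMetric

variable {Γ : Fin 2 → Fin 2 → Fin 2 → Plane → ℝ} {g : Plane → Matrix (Fin 2) (Fin 2) ℝ} {K : ℝ}
  {U : Set Plane} {x : Plane}

lemma contDiffAt_christoffel (hg : IsConstCurvMetric Γ g K U) (hx : x ∈ U) (i j k : Fin 2) :
    ContDiffAt ℝ ∞ (Γ i j k) x :=
  (hg.contDiffOn_christoffel i j k).contDiffAt (hg.isOpen.mem_nhds hx)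

lemma contDiffAt_metric (hg : IsConstCurvMetric Γ g K U) (hx : x ∈ U) (i j : Fin 2) :
    ContDiffAt ℝ ∞ (fun y => g y i j) x :=
  (hg.contDiffOn_metric i j).contDiffAt (hg.isOpen.mem_nhds hx)

lemma differentiableAt_christoffel (hg : IsConstCurvMetric Γ g K U) (hx : x ∈ U) (i j k : Fin 2) :
    DifferentiableAt ℝ (Γ i j k) x :=
  (hg.contDiffAt_christoffel hx i j k).differentiableAt (by simp)

lemma differentiableAt_metric (hg : IsConstCurvMetric Γ g K U) (hx : x ∈ U) (i j : Fin 2) :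
    DifferentiableAt ℝ (fun y => g y i j) x :=
  (hg.contDiffAt_metric hx i j).differentiableAt (by simp)

lemma smul (hg : IsConstCurvMetric Γ g K U) {c : ℝ} (hc : c ≠ 0) :
    IsConstCurvMetric Γ (fun x => c • g x) (c⁻¹ * K) U where
  isOpen := hg.isOpen
  contDiffOn_christoffel := hg.contDiffOn_christoffel
  christoffel_symm := hg.christoffel_symm
  contDiffOn_metric i j := contDiffOn_const.mul (hg.contDiffOn_metric i j)
  metric_symm x hx := (hg.metric_symm x hx).smul c
  det_ne_zero x hx := by
    rw [Matrix.det_smul]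
    exact mul_ne_zero (pow_ne_zero _ hc) (hg.det_ne_zero x hx)
  parallel x hx l i j := by
    have h1 : pderiv l (fun y => (c • g y) i j) x = c * pderiv l (fun y => g y i j) x :=
      pderiv_const_mul l c (hg.differentiableAt_metric hx i j)
    rw [h1, hg.parallel x hx, Finset.mul_sum]
    refine Finset.sum_congr rfl fun m _ => ?_
    simp only [Matrix.smul_apply, smul_eq_mul]
    ring
  curvature x hx := by
    have h := hg.curvature x hx
    rw [Matrix.det_smul, Fintype.card_fin]
    simp only [Matrix.smul_apply, smul_eq_mul] at h ⊢
    rw [show c⁻¹ * K * (c ^ 2 * (g x).det) = c * (K * (g x).det) by field_simp, ← h, Finset.mul_sum]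
    exact Finset.sum_congr rfl fun m _ => by ring

/-- In dimension two the curvature is determined by the Gauss curvature:
`R(∂₁, ∂₂) ∂_j = K (g_{2j} ∂₁ - g_{1j} ∂₂)`. -/
lemma curvature_eq (hg : IsConstCurvMetric Γ g K U) (hx : x ∈ U) (j l : Fin 2) :
    pderiv 0 (Γ 1 j l) x - pderiv 1 (Γ 0 j l) x +
      ∑ m, (Γ 0 m l x * Γ 1 j m x - Γ 1 m l x * Γ 0 j m x) =
    K * (g x 1 j * (if l = 0 then 1 else 0) - g x 0 j * (if l = 1 then 1 else 0)) := by
  set R : Fin 2 → Fin 2 → ℝ := fun j l => pderiv 0 (Γ 1 j l) x - pderiv 1 (Γ 0 j l) x +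
      ∑ m, (Γ 0 m l x * Γ 1 j m x - Γ 1 m l x * Γ 0 j m x) with hR
  have hΓd (i j k) := hg.differentiableAt_christoffel hx i j k
  have hgd (i j) := hg.differentiableAt_metric hx i j
  -- the second derivatives of the metric commute, so the curvature is skew
  have hskew (j k : Fin 2) : ∑ l, R j l * g x l k + ∑ l, R k l * g x j l = 0 := by
    have hpar (l : Fin 2) : pderiv l (fun y => g y j k) =ᶠ[𝓝 x]
        fun y => (Γ l j 0 y * g y 0 k + Γ l k 0 y * g y j 0) +
          (Γ l j 1 y * g y 1 k + Γ l k 1 y * g y j 1) := by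
      filter_upwards [hg.isOpen.mem_nhds hx] with y hy
      rw [hg.parallel y hy, Fin.sum_univ_two]
    have hcomm := pderiv_comm (hg.contDiffAt_metric hx j k) 0 1
    rw [pderiv_congr 0 (hpar 1), pderiv_congr 1 (hpar 0)] at hcomm
    simp (disch := fun_prop) only [pderiv_add, pderiv_mul] at hcomm
    simp only [hg.parallel x hx, Fin.sum_univ_two] at hcomm
    simp only [hR, Fin.sum_univ_two]
    linear_combination hcomm
  have h10 : g x 1 0 = g x 0 1 := (hg.metric_symm x hx).apply 0 1
  have hdet := hg.det_ne_zero x hx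
  have hcurv : ∑ l, R 1 l * g x l 0 = K * (g x).det := hg.curvature x hx
  rw [Matrix.det_fin_two, h10] at hdet hcurv
  have h00 := hskew 0 0
  have h01 := hskew 0 1
  have h11 := hskew 1 1
  simp only [Fin.sum_univ_two, h10] at h00 h01 h11 hcurv
  change R j l = _
  apply mul_left_cancel₀ hdet
  fin_cases j <;> fin_cases l <;> simp [h10, -mul_eq_mul_left_iff]
  · linear_combination g x 1 1 / 2 * h00 - g x 0 1 * h01 + g x 0 1 * hcurv
  · linear_combination g x 0 0 * h01 - g x 0 0 * hcurv - g x 0 1 / 2 * h00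
  · linear_combination g x 1 1 * hcurv - g x 0 1 / 2 * h11
  · linear_combination g x 0 0 / 2 * h11 - g x 0 1 * hcurv

end IsConstCurvMetric

/-! ### The Hessian equation -/

section HessianEquation

variable {Γ : Fin 2 → Fin 2 → Fin 2 → Plane → ℝ} {g : Plane → Matrix (Fin 2) (Fin 2) ℝ} {K : ℝ}
  {U : Set Plane}

/-- Near `x₀`, the function `f` is smooth and satisfies `∇df = -K f g`. On a model surface these
functions are the restrictions of the linear functions of the ambient three-space. -/
structure IsHessianSolution (Γ : Fin 2 → Fin 2 → Fin 2 → Plane → ℝ)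
    (g : Plane → Matrix (Fin 2) (Fin 2) ℝ) (K : ℝ) (x₀ : Plane) (f : Plane → ℝ) : Prop where
  eventually_contDiffAt : ∀ᶠ x in 𝓝 x₀, ContDiffAt ℝ ∞ f x
  eventually_hessian : ∀ᶠ x in 𝓝 x₀, ∀ i j, pderiv i (pderiv j f) x =
    ∑ m, Γ i j m x * pderiv m f x - K * f x * g x i j

/-- The indices of the unknowns `(x, f, df)` of the first order system equivalent to the Hessian
equation: a coordinate, the function itself (`none`), or one of its partial derivatives. -/
abbrev HessianIndex : Type := Fin 2 ⊕ Option (Fin 2)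

/-- The point of the plane encoded in a vector of unknowns. -/
def hessianPoint (v : HessianIndex → ℝ) : Plane := WithLp.toLp 2 fun l => v (Sum.inl l)

/-- The right-hand sides of the first order system equivalent to the Hessian equation. -/
def hessianSystem (Γ : Fin 2 → Fin 2 → Fin 2 → Plane → ℝ) (g : Plane → Matrix (Fin 2) (Fin 2) ℝ)
    (K : ℝ) (i : Fin 2) : HessianIndex → (HessianIndex → ℝ) → ℝ
  | Sum.inl j => fun _ => if i = j then 1 else 0
  | Sum.inr none => fun v => v (Sum.inr (some i))
  | Sum.inr (some j) => fun v => ∑ m, Γ i j m (hessianPoint v) * v (Sum.inr (some m)) -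
      K * v (Sum.inr none) * g (hessianPoint v) i j

lemma contDiff_hessianPoint {n : WithTop ℕ∞} : ContDiff ℝ n hessianPoint :=
  (PiLp.contDiff_toLp (p := 2)).comp (contDiff_pi.2 fun _ => contDiff_apply ℝ ℝ _)

lemma fderiv_comp_hessianPoint {f : Plane → ℝ} {v : HessianIndex → ℝ}
    (hf : DifferentiableAt ℝ f (hessianPoint v)) (w : HessianIndex → ℝ) (j : Fin 2)
    (hw : ∀ l, w (Sum.inl l) = if j = l then 1 else 0) :
    fderiv ℝ (fun v => f (hessianPoint v)) v w = pderiv j f (hessianPoint v) := by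
  let L : (HessianIndex → ℝ) →L[ℝ] Plane := LinearMap.toContinuousLinearMap
    { toFun := hessianPoint
      map_add' := fun _ _ => rfl
      map_smul' := fun _ _ => rfl }
  have h1 := (hf.hasFDerivAt (x := L v)).comp v L.hasFDerivAt
  have h2 : L w = EuclideanSpace.single j 1 := by
    ext l
    change w (Sum.inl l) = _
    rw [hw]
    simp [eq_comm]
  have h3 := congrArg (fun A : (HessianIndex → ℝ) →L[ℝ] ℝ => A w) h1.fderiv
  exact h3.trans (congrArg (fderiv ℝ f (hessianPoint v)) h2)

variable (hg : IsConstCurvMetric Γ g K U)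
include hg

lemma contDiffAt_hessianSystem {v : HessianIndex → ℝ} (hv : hessianPoint v ∈ U)
    (i : Fin 2) (a : HessianIndex) : ContDiffAt ℝ ∞ (hessianSystem Γ g K i a) v := by
  have hc (b : HessianIndex) : ContDiffAt ℝ ∞ (fun v : HessianIndex → ℝ => v b) v :=
    (contDiff_apply ℝ ℝ b).contDiffAt
  rcases a with j | _ | j
  · exact contDiffAt_const
  · exact hc _
  · exact (ContDiffAt.sum fun m _ => ((hg.contDiffAt_christoffel hv i j m).comp v
      contDiff_hessianPoint.contDiffAt).mul (hc _)).sub ((contDiffAt_const.mul (hc _)).mul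
        (ContDiffAt.comp (g := fun y => g y i j) v (hg.contDiffAt_metric hv i j)
          contDiff_hessianPoint.contDiffAt))

lemma fderiv_hessianSystem_some {v : HessianIndex → ℝ} (hv : hessianPoint v ∈ U)
    (i j l : Fin 2) (w : HessianIndex → ℝ)
    (hw : ∀ l, w (Sum.inl l) = if j = l then 1 else 0) :
    fderiv ℝ (hessianSystem Γ g K i (Sum.inr (some l))) v w =
      ∑ m, (pderiv j (Γ i l m) (hessianPoint v) * v (Sum.inr (some m)) +
        Γ i l m (hessianPoint v) * w (Sum.inr (some m))) -
      K * (w (Sum.inr none) * g (hessianPoint v) i l +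
        v (Sum.inr none) * pderiv j (fun y => g y i l) (hessianPoint v)) := by
  have hp (b : HessianIndex) : HasFDerivAt (fun v : HessianIndex → ℝ => v b)
      (ContinuousLinearMap.proj (R := ℝ) (φ := fun _ : HessianIndex => ℝ) b) v :=
    hasFDerivAt_apply b v
  have hX : DifferentiableAt ℝ hessianPoint v :=
    (contDiff_hessianPoint (n := 1)).contDiffAt.differentiableAt one_ne_zero
  have hΓ (m) : HasFDerivAt (fun v => Γ i l m (hessianPoint v))
      (fderiv ℝ (fun v => Γ i l m (hessianPoint v)) v) v :=
    ((hg.differentiableAt_christoffel hv i l m).comp v hX).hasFDerivAt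
  have hgd : HasFDerivAt (fun v => g (hessianPoint v) i l)
      (fderiv ℝ (fun v => g (hessianPoint v) i l) v) v :=
    (DifferentiableAt.comp (g := fun y => g y i l) v (hg.differentiableAt_metric hv i l)
      hX).hasFDerivAt
  have h := (HasFDerivAt.fun_sum (u := Finset.univ) fun m _ =>
    (hΓ m).mul (hp (Sum.inr (some m)))).sub (((hp (Sum.inr none)).const_mul K).mul hgd)
  have h' := congrArg (fun L : (HessianIndex → ℝ) →L[ℝ] ℝ => L w) h.fderiv
  refine h'.trans ?_
  have h1 (m) := fderiv_comp_hessianPoint (hg.differentiableAt_christoffel hv i l m) w j hw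
  have h2 := fderiv_comp_hessianPoint (hg.differentiableAt_metric hv i l) w j hw
  simp only [sub_apply, add_apply, smul_apply, smul_eq_mul, h1, h2,
    ContinuousLinearMap.proj_apply, Fin.sum_univ_two]
  ring

/-- The integrability condition of the Hessian equation: this is where constancy of the Gauss
curvature enters. -/
lemma fderiv_hessianSystem_symm {v : HessianIndex → ℝ} (hv : hessianPoint v ∈ U)
    (i j : Fin 2) (a : HessianIndex) :
    fderiv ℝ (hessianSystem Γ g K i a) v (fun b => hessianSystem Γ g K j b v) =
      fderiv ℝ (hessianSystem Γ g K j a) v (fun b => hessianSystem Γ g K i b v) := by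
  have hgs : g (hessianPoint v) 1 0 = g (hessianPoint v) 0 1 := (hg.metric_symm _ hv).apply 0 1
  rcases a with l | _ | l
  · simp [hessianSystem]
  · have h (i) : fderiv ℝ (hessianSystem Γ g K i (Sum.inr none)) v =
        ContinuousLinearMap.proj (Sum.inr (some i)) :=
      (ContinuousLinearMap.proj (R := ℝ) (φ := fun _ : HessianIndex => ℝ)
        (Sum.inr (some i))).fderiv
    rw [h, h]
    simp only [ContinuousLinearMap.proj_apply, hessianSystem, hg.christoffel_symm _ hv j i,
      (hg.metric_symm _ hv).apply i j]
  · have hΓ10 (k) := hg.christoffel_symm _ hv 1 0 k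
    have hin (j l : Fin 2) : hessianSystem Γ g K j (Sum.inl l) v = if j = l then 1 else 0 := rfl
    have hcurv (m) := hg.curvature_eq hv l m
    have h := fderiv_hessianSystem_some hg hv
    have h01 : fderiv ℝ (hessianSystem Γ g K 0 (Sum.inr (some l))) v
        (fun b => hessianSystem Γ g K 1 b v) =
        fderiv ℝ (hessianSystem Γ g K 1 (Sum.inr (some l))) v
          (fun b => hessianSystem Γ g K 0 b v) := by
      rw [h 0 1 l _ (hin 1), h 1 0 l _ (hin 0)]
      have hcurv0 := hcurv 0
      have hcurv1 := hcurv 1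
      simp only [hessianSystem, hg.parallel _ hv, Fin.sum_univ_two, hΓ10, hgs, if_true,
        zero_ne_one, one_ne_zero, if_false] at hcurv0 hcurv1 ⊢
      linear_combination -v (Sum.inr (some 0)) * hcurv0 - v (Sum.inr (some 1)) * hcurv1
    fin_cases i <;> fin_cases j
    · rfl
    · exact h01
    · exact h01.symm
    · rfl

/-- The Hessian equation has a local solution with arbitrary value and differential at a point. -/
theorem exists_isHessianSolution {x₀ : Plane} (hx₀ : x₀ ∈ U) (c : ℝ) (α : Fin 2 → ℝ) :
    ∃ f, IsHessianSolution Γ g K x₀ f ∧ f x₀ = c ∧ ∀ i, pderiv i f x₀ = α i := by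
  set F := totalDifferential (hessianSystem Γ g K) with hF
  set v₀ : HessianIndex → ℝ := Sum.elim (fun l => x₀ l) (fun o => o.elim c α) with hv₀
  have hxv : hessianPoint v₀ = x₀ := rfl
  have hopen : IsOpen (hessianPoint ⁻¹' U) :=
    hg.isOpen.preimage (contDiff_hessianPoint (n := 0)).continuous
  have hFd : ContDiffOn ℝ ∞ F (hessianPoint ⁻¹' U) := fun v hv =>
    (contDiffAt_totalDifferential fun i a => contDiffAt_hessianSystem hg hv i a).contDiffWithinAt
  have hnhds : hessianPoint ⁻¹' U ∈ 𝓝 v₀ := hopen.mem_nhds hx₀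
  obtain ⟨u, hu₀, hu⟩ := exists_eventually_hasFDerivAt (F := F) (c := v₀)
    ((hFd.contDiffAt hnhds).of_le (by simp)) (by
      filter_upwards [hnhds] with v hv h k
      exact fderiv_totalDifferential_symm (fun i a =>
        (contDiffAt_hessianSystem hg hv i a).of_le (by simp)) (fderiv_hessianSystem_symm hg hv)
          h k) x₀
  obtain ⟨ε, hε, hball⟩ := Metric.eventually_nhds_iff_ball.1 (hu.and
    (hu.self_of_nhds.continuousAt.eventually (hu₀ ▸ hnhds)))
  have hsmooth : ContDiffOn ℝ ∞ u (Metric.ball x₀ ε) :=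
    contDiffOn_of_hasFDerivAt Metric.isOpen_ball hFd (fun x hx => (hball x hx).2)
      (fun x hx => (hball x hx).1)
  have hb := Metric.ball_mem_nhds x₀ hε
  have hd (a : HessianIndex) {x : Plane} (hx : x ∈ Metric.ball x₀ ε) :
      ContDiffAt ℝ ∞ (fun y => u y a) x :=
    (contDiff_apply ℝ ℝ a).contDiffAt.comp x (hsmooth.contDiffAt (Metric.isOpen_ball.mem_nhds hx))
  have hpd (i : Fin 2) (a : HessianIndex) {x : Plane} (hx : x ∈ Metric.ball x₀ ε) :
      pderiv i (fun y => u y a) x = hessianSystem Γ g K i a (u x) :=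
    pderiv_of_hasFDerivAt (hball x hx).1 i a
  -- the unknowns for the point are the point, since both have the same derivative and agree at `x₀`
  have hpt : ∀ᶠ x in 𝓝 x₀, hessianPoint (u x) = x := by
    have h (l : Fin 2) : ∀ᶠ x in 𝓝 x₀, u x (Sum.inl l) - x l = u x₀ (Sum.inl l) - x₀ l := by
      have hc (x : Plane) : DifferentiableAt ℝ (fun y : Plane => y l) x :=
        (contDiffAt_coord (n := 1) l).differentiableAt one_ne_zero
      refine eventually_eq_of_pderiv_eq_zero (f := fun x : Plane => u x (Sum.inl l) - x l) ?_ ?_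
      · filter_upwards [hb] with x hx
        exact ((hd _ hx).differentiableAt (by simp)).sub (hc x)
      · filter_upwards [hb] with x hx i
        rw [pderiv_sub i ((hd _ hx).differentiableAt (by simp)) (hc x), hpd i _ hx,
          show pderiv i (fun y : Plane => y l) x = _ from pderiv_coord differentiableAt_id i l]
        simp [hessianSystem, eq_comm]
    filter_upwards [h 0, h 1] with x h0 h1
    rw [hu₀, hv₀, Sum.elim_inl, sub_self, sub_eq_zero] at h0 h1
    ext l
    fin_cases l
    · exact h0
    · exact h1
  have hev (i : Fin 2) {x : Plane} (hx : x ∈ Metric.ball x₀ ε) :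
      pderiv i (fun y => u y (Sum.inr none)) =ᶠ[𝓝 x] fun y => u y (Sum.inr (some i)) := by
    filter_upwards [Metric.isOpen_ball.mem_nhds hx] with y hy
    exact hpd i _ hy
  refine ⟨fun x => u x (Sum.inr none), ⟨?_, ?_⟩, by simp [hu₀, hv₀], fun i => ?_⟩
  · filter_upwards [hb] with x hx
    exact hd _ hx
  · filter_upwards [hb, hpt] with x hx hux i j
    rw [pderiv_congr i (hev j hx), hpd i _ hx]
    simp only [hessianSystem, hux, (hev _ hx).self_of_nhds]
  · rw [(hev i (Metric.mem_ball_self hε)).self_of_nhds]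
    simp [hu₀, hv₀]

end HessianEquation

/-! ### Inner products of covectors -/

section Cometric

/-- The inner product of two covectors with respect to the symmetric matrix `m` of an inner
product of vectors. It is given by the inverse matrix of `m`, whose entries are written out; only
the entry `m 0 1` is used off the diagonal. -/
def cometric (m : Matrix (Fin 2) (Fin 2) ℝ) (v w : Fin 2 → ℝ) : ℝ :=
  (m 1 1 * (v 0 * w 0) - m 0 1 * (v 0 * w 1 + v 1 * w 0) + m 0 0 * (v 1 * w 1)) * m.det⁻¹

variable {m : Matrix (Fin 2) (Fin 2) ℝ} {v w : Fin 2 → ℝ}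

lemma cometric_combination (m : Matrix (Fin 2) (Fin 2) ℝ) (a b c d : ℝ) (v w v' w' : Fin 2 → ℝ) :
    cometric m (fun i => a * v i + b * w i) (fun i => c * v' i + d * w' i) =
      a * c * cometric m v v' + a * d * cometric m v w' + b * c * cometric m w v' +
        b * d * cometric m w w' := by
  simp only [cometric]
  ring

lemma cometric_comm (m : Matrix (Fin 2) (Fin 2) ℝ) (v w : Fin 2 → ℝ) :
    cometric m v w = cometric m w v := by
  simp only [cometric]
  ring

lemma cometric_neg (m : Matrix (Fin 2) (Fin 2) ℝ) (v w : Fin 2 → ℝ) :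
    cometric ((-1 : ℝ) • m) v w = -cometric m v w := by
  simp only [cometric, Matrix.det_smul, Matrix.smul_apply, smul_eq_mul, Fintype.card_fin]
  ring

/-- Three covectors in dimension two are linearly dependent, so their Gram determinant vanishes. -/
lemma cometric_gram (m : Matrix (Fin 2) (Fin 2) ℝ) (u v w : Fin 2 → ℝ) :
    cometric m u u * (cometric m v v * cometric m w w - cometric m v w ^ 2) -
      cometric m u v * (cometric m u v * cometric m w w - cometric m v w * cometric m u w) +
      cometric m u w * (cometric m u v * cometric m v w - cometric m v v * cometric m u w) = 0 := by
  simp only [cometric]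
  ring

lemma exists_cometric_ne_zero (hm : m.IsSymm) (hdet : m.det ≠ 0) : ∃ v, cometric m v v ≠ 0 := by
  by_contra! h
  have h10 : m 1 0 = m 0 1 := hm.apply 0 1
  have h0 := h ![1, 0]
  have h1 := h ![0, 1]
  have h2 := h ![1, 1]
  simp [cometric, hdet] at h0 h1 h2
  rw [Matrix.det_fin_two, h0, h1, h10] at hdet
  simp only [h0, h1] at h2
  apply hdet
  rw [show m 0 1 = 0 by linarith]
  ring

/-- A covector of positive square extends to an orthonormal pair of covectors. -/
lemma exists_orthonormal_covectors (hm : m.IsSymm) (hdet : m.det ≠ 0) (hv : 0 < cometric m v v) :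
    ∃ (α β : Fin 2 → ℝ) (ε : ℝ), (ε = 1 ∨ ε = -1) ∧ cometric m α α = 1 ∧ cometric m α β = 0 ∧
      cometric m β β = ε := by
  have h10 : m 1 0 = m 0 1 := hm.apply 0 1
  have hD : m.det = m 0 0 * m 1 1 - m 0 1 * m 0 1 := by rw [Matrix.det_fin_two, h10]
  set r := (√(cometric m v v))⁻¹ with hr
  have hr2 : r * r * cometric m v v = 1 := by
    rw [hr, ← mul_inv, Real.mul_self_sqrt hv.le, inv_mul_cancel₀ hv.ne']
  set t := √|m.det| with ht
  have ht2 : t * t = |m.det| := Real.mul_self_sqrt (abs_nonneg _)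
  have hsq : ∃ ε : ℝ, (ε = 1 ∨ ε = -1) ∧ |m.det| = ε * m.det := by
    rcases abs_choice m.det with h | h
    · exact ⟨1, Or.inl rfl, by rw [h, one_mul]⟩
    · exact ⟨-1, Or.inr rfl, by rw [h, neg_one_mul]⟩
  obtain ⟨ε, hε, habs⟩ := hsq
  -- the second covector is the first one turned into a vector and rotated by a right angle
  refine ⟨fun i => r * v i, ![-(t * r * m.det⁻¹ * (m 0 0 * v 1 - m 0 1 * v 0)),
    t * r * m.det⁻¹ * (m 1 1 * v 0 - m 0 1 * v 1)], ε, hε, ?_, ?_, ?_⟩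
  · rw [← hr2]
    simp only [cometric]
    ring
  · simp only [cometric, Matrix.cons_val_zero, Matrix.cons_val_one]
    ring
  · have hε' : ε = t * t * m.det⁻¹ * (r * r * cometric m v v) := by
      rw [ht2, hr2, habs]
      field_simp
    rw [hε']
    simp only [cometric, Matrix.cons_val_zero, Matrix.cons_val_one]
    field_simp
    rw [hD]
    ring

/-- The inner product of covectors determines the inner product of vectors. -/
lemma eq_of_cometric_eq (hm : m.IsSymm) (hdet : m.det ≠ 0) {μ ε : ℝ} (hμ : μ ≠ 0)
    (hε : ε = 1 ∨ ε = -1) (hvv : cometric m v v = μ) (hvw : cometric m v w = 0)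
    (hww : cometric m w w = ε * μ) :
    v 0 * w 1 - v 1 * w 0 ≠ 0 ∧ ∀ i j, m i j = μ⁻¹ * (v i * v j + ε * (w i * w j)) := by
  have h10 : m 1 0 = m 0 1 := hm.apply 0 1
  have hD : m.det = m 0 0 * m 1 1 - m 0 1 * m 0 1 := by rw [Matrix.det_fin_two, h10]
  have hε2 : ε * ε = 1 := by rcases hε with rfl | rfl <;> norm_num
  have hε0 : ε ≠ 0 := by rintro rfl; simp at hε2
  rw [cometric, ← div_eq_mul_inv, div_eq_iff hdet] at hvv hvw hww
  -- the Gram determinant of `v` and `w`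
  have hδ : (v 0 * w 1 - v 1 * w 0) ^ 2 = ε * μ ^ 2 * m.det := by
    apply mul_left_cancel₀ hdet
    conv_lhs => rw [hD]
    linear_combination (m 1 1 * (w 0 * w 0) - m 0 1 * (w 0 * w 1 + w 1 * w 0) +
      m 0 0 * (w 1 * w 1)) * hvv - (m 1 1 * (v 0 * w 0) - m 0 1 * (v 0 * w 1 + v 1 * w 0) +
      m 0 0 * (v 1 * w 1)) * hvw + μ * m.det * hww
  have hne : ε * μ ^ 2 * m.det ≠ 0 := mul_ne_zero (mul_ne_zero hε0 (pow_ne_zero _ hμ)) hdet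
  refine ⟨fun h => hne (by rw [← hδ, h]; ring), ?_⟩
  have hsolve {a b : ℝ} (h : a * (ε * μ ^ 2 * m.det) = ε * μ * m.det * b) : a = μ⁻¹ * b := by
    apply mul_right_cancel₀ hne
    rw [h]
    field_simp
  have h00 : m 0 0 = μ⁻¹ * (v 0 * v 0 + ε * (w 0 * w 0)) := hsolve (by
    rw [← hδ]
    linear_combination w 0 ^ 2 * hvv - 2 * v 0 * w 0 * hvw + v 0 ^ 2 * hww -
      w 0 ^ 2 * μ * m.det * hε2)
  have h11 : m 1 1 = μ⁻¹ * (v 1 * v 1 + ε * (w 1 * w 1)) := hsolve (by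
    rw [← hδ]
    linear_combination w 1 ^ 2 * hvv - 2 * v 1 * w 1 * hvw + v 1 ^ 2 * hww -
      w 1 ^ 2 * μ * m.det * hε2)
  have h01 : m 0 1 = μ⁻¹ * (v 0 * v 1 + ε * (w 0 * w 1)) := hsolve (by
    rw [← hδ]
    linear_combination w 0 * w 1 * hvv - (v 0 * w 1 + v 1 * w 0) * hvw + v 0 * v 1 * hww -
      w 0 * w 1 * μ * m.det * hε2)
  intro i j
  fin_cases i <;> fin_cases j
  · exact h00
  · exact h01
  · exact (h10.trans h01).trans (by simp only [Fin.mk_one, Fin.zero_eta]; ring)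
  · exact h11

end Cometric

/-! ### The conserved quantity of the Hessian equation -/

section Conservation

variable {Γ : Fin 2 → Fin 2 → Fin 2 → Plane → ℝ} {g : Plane → Matrix (Fin 2) (Fin 2) ℝ} {K : ℝ}
  {U : Set Plane} {x₀ : Plane} {f h : Plane → ℝ}

/-- The components of the differential of a function. -/
def differential (f : Plane → ℝ) (x : Plane) : Fin 2 → ℝ := fun i => pderiv i f x

/-- For two solutions of the Hessian equation, `⟨df, dh⟩ + K f h` is constant. -/
lemma IsHessianSolution.eventually_conserved (hg : IsConstCurvMetric Γ g K U) (hx₀ : x₀ ∈ U)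
    (hf : IsHessianSolution Γ g K x₀ f) (hh : IsHessianSolution Γ g K x₀ h) :
    ∀ᶠ x in 𝓝 x₀, cometric (g x) (differential f x) (differential h x) + K * (f x * h x) =
      cometric (g x₀) (differential f x₀) (differential h x₀) + K * (f x₀ * h x₀) := by
  have hd {f : Plane → ℝ} {x : Plane} (hf : ContDiffAt ℝ ∞ f x) : DifferentiableAt ℝ f x :=
    hf.differentiableAt (by simp)
  have hpd {f : Plane → ℝ} {x : Plane} (hf : ContDiffAt ℝ ∞ f x) (i : Fin 2) :
      DifferentiableAt ℝ (pderiv i f) x :=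
    (contDiffAt_pderiv (m := 1) hf (by rw [one_add_one_eq_two]; exact ENat.LEInfty.out)
      i).differentiableAt one_ne_zero
  refine eventually_eq_of_pderiv_eq_zero ?_ ?_
  all_goals
    filter_upwards [hg.isOpen.mem_nhds hx₀, hf.eventually_contDiffAt, hh.eventually_contDiffAt,
      hf.eventually_hessian, hh.eventually_hessian] with x hx hfc hhc hf2 hh2
    have hgd (i j) := hg.differentiableAt_metric hx i j
    have hf1 := hd hfc
    have hh1 := hd hhc
    have hfi (i) := hpd hfc i
    have hhi (i) := hpd hhc i
    have hdet := hg.det_ne_zero x hx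
    simp only [cometric, Matrix.det_fin_two, differential] at hdet ⊢
  · fun_prop (disch := assumption)
  · intro l
    have h10 : g x 1 0 = g x 0 1 := (hg.metric_symm x hx).apply 0 1
    simp (disch := first | assumption | fun_prop (disch := assumption)) only
      [pderiv_add, pderiv_mul, pderiv_sub, pderiv_inv]
    have hK : pderiv l (fun _ => K) x = 0 := by simp [pderiv]
    rw [h10] at hdet
    simp only [hg.parallel x hx, hf2, hh2, hK, Fin.sum_univ_two, h10] at hdet ⊢
    obtain ⟨D, hD⟩ : ∃ D, D = g x 0 0 * g x 1 1 - g x 0 1 * g x 0 1 := ⟨_, rfl⟩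
    rw [← hD] at hdet ⊢
    field_simp
    rw [hD]
    fin_cases l
    · simp only [Fin.zero_eta]
      ring
    · simp only [Fin.mk_one, h10]
      ring

end Conservation

/-! ### Local isometries to the model metrics -/

section NormalForms

/-- Near `x₀` the map `φ` is a local diffeomorphism which pulls the metric `g'` back to `g`. -/
def IsLocalIsometry (g g' : Plane → Matrix (Fin 2) (Fin 2) ℝ) (φ : Plane → Plane) (x₀ : Plane) :
    Prop :=
  ∀ᶠ x in 𝓝 x₀, ContDiffAt ℝ ∞ φ x ∧
    pderiv 0 (fun y => φ y 0) x * pderiv 1 (fun y => φ y 1) x -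
      pderiv 1 (fun y => φ y 0) x * pderiv 0 (fun y => φ y 1) x ≠ 0 ∧
    ∀ i j, g x i j = ∑ a, ∑ b, g' (φ x) a b *
      (pderiv i (fun y => φ y a) x * pderiv j (fun y => φ y b) x)

variable {Γ : Fin 2 → Fin 2 → Fin 2 → Plane → ℝ} {g : Plane → Matrix (Fin 2) (Fin 2) ℝ} {K : ℝ}
  {U : Set Plane} {x₀ : Plane}

/-- The pullback condition can be checked on covectors, where it involves only the inner products
of the differentials of the components. -/
lemma isLocalIsometry_of_cometric (hg : IsConstCurvMetric Γ g K U) (hx₀ : x₀ ∈ U)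
    {g' : Plane → Matrix (Fin 2) (Fin 2) ℝ} {p q μ : Plane → ℝ} {ε : ℝ} (hε : ε = 1 ∨ ε = -1)
    (hp : ∀ᶠ x in 𝓝 x₀, ContDiffAt ℝ ∞ p x) (hq : ∀ᶠ x in 𝓝 x₀, ContDiffAt ℝ ∞ q x)
    (h : ∀ᶠ x in 𝓝 x₀, μ x ≠ 0 ∧ cometric (g x) (differential p x) (differential p x) = μ x ∧
      cometric (g x) (differential p x) (differential q x) = 0 ∧
      cometric (g x) (differential q x) (differential q x) = ε * μ x ∧
      g' !₂[p x, q x] = (μ x)⁻¹ • !![1, 0; 0, ε]) :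
    IsLocalIsometry g g' (fun x => !₂[p x, q x]) x₀ := by
  filter_upwards [hg.isOpen.mem_nhds hx₀, hp, hq, h] with x hx hp hq ⟨hμ, hpp, hpq, hqq, hg'⟩
  obtain ⟨hJ, hm⟩ := eq_of_cometric_eq (hg.metric_symm x hx) (hg.det_ne_zero x hx) hμ hε hpp hpq hqq
  refine ⟨(PiLp.contDiff_toLp (p := 2)).contDiffAt.comp x (contDiffAt_pi.2 fun a => ?_), hJ,
    fun i j => ?_⟩
  · fin_cases a
    · exact hp
    · exact hq
  · rw [hm, hg']
    simp [differential, Fin.sum_univ_two]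
    ring

lemma exists_isHessianSolution_differential (hg : IsConstCurvMetric Γ g K U) (hx₀ : x₀ ∈ U)
    (c : ℝ) (α : Fin 2 → ℝ) :
    ∃ f, IsHessianSolution Γ g K x₀ f ∧ f x₀ = c ∧ differential f x₀ = α := by
  obtain ⟨f, hf, h0, h1⟩ := exists_isHessianSolution hg hx₀ c α
  exact ⟨f, hf, h0, funext h1⟩

/-- Without curvature, two solutions with orthonormal differentials are flat coordinates. -/
lemma exists_isLocalIsometry_flat (hg : IsConstCurvMetric Γ g 0 U) (hx₀ : x₀ ∈ U)
    {v : Fin 2 → ℝ} (hv : 0 < cometric (g x₀) v v) :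
    ∃ (φ : Plane → Plane) (ε : ℝ), (ε = 1 ∨ ε = -1) ∧
      IsLocalIsometry g (fun _ => !![1, 0; 0, ε]) φ x₀ := by
  obtain ⟨α, β, ε, hε, hαα, hαβ, hββ⟩ :=
    exists_orthonormal_covectors (hg.metric_symm x₀ hx₀) (hg.det_ne_zero x₀ hx₀) hv
  obtain ⟨p, hp, -, hp1⟩ := exists_isHessianSolution_differential hg hx₀ 0 α
  obtain ⟨q, hq, -, hq1⟩ := exists_isHessianSolution_differential hg hx₀ 0 β
  refine ⟨_, ε, hε, isLocalIsometry_of_cometric hg hx₀ (μ := fun _ => 1) hε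
    hp.eventually_contDiffAt hq.eventually_contDiffAt ?_⟩
  filter_upwards [hp.eventually_conserved hg hx₀ hp, hp.eventually_conserved hg hx₀ hq,
    hq.eventually_conserved hg hx₀ hq] with x hpp hpq hqq
  rw [hp1] at hpp
  rw [hp1, hq1] at hpq
  rw [hq1] at hqq
  simp only [zero_mul, add_zero, hαα, hαβ, hββ] at hpp hpq hqq
  exact ⟨one_ne_zero, hpp, hpq, by rw [hqq, mul_one], by simp⟩

lemma differential_div {f s : Plane → ℝ} {x : Plane} (hf : DifferentiableAt ℝ f x)
    (hs : DifferentiableAt ℝ s x) (h0 : s x ≠ 0) :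
    differential (fun y => f y * (s y)⁻¹) x =
      fun i => (s x)⁻¹ * differential f x i + (-f x * (s x ^ 2)⁻¹) * differential s x i := by
  funext i
  simp only [differential]
  rw [pderiv_mul i hf (hs.fun_inv h0), pderiv_inv i hs h0]
  ring

/-- In curvature `-1`, if `p` and `q` solve the Hessian equation, `p = 1` and `q = 0` at `x₀`, and
their differentials are orthonormal there, then `(1 / p, q / p)` are half-plane coordinates. -/
lemma exists_isLocalIsometry_halfPlane (hg : IsConstCurvMetric Γ g (-1) U) (hx₀ : x₀ ∈ U)
    {v : Fin 2 → ℝ} (hv : 0 < cometric (g x₀) v v) :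
    ∃ (φ : Plane → Plane) (ε : ℝ), (ε = 1 ∨ ε = -1) ∧
      IsLocalIsometry g (halfPlaneMetric ε) φ x₀ ∧ ∀ᶠ x in 𝓝 x₀, 0 < φ x 0 := by
  obtain ⟨α, β, ε, hε, hαα, hαβ, hββ⟩ :=
    exists_orthonormal_covectors (hg.metric_symm x₀ hx₀) (hg.det_ne_zero x₀ hx₀) hv
  obtain ⟨p, hp, hp0, hp1⟩ := exists_isHessianSolution_differential hg hx₀ 1 α
  obtain ⟨q, hq, hq0, hq1⟩ := exists_isHessianSolution_differential hg hx₀ 0 β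
  have hpc := hp.eventually_contDiffAt
  have hqc := hq.eventually_contDiffAt
  have hpos : ∀ᶠ x in 𝓝 x₀, 0 < p x :=
    hpc.self_of_nhds.continuousAt.eventually (lt_mem_nhds (by rw [hp0]; exact one_pos))
  refine ⟨fun x => !₂[1 * (p x)⁻¹, q x * (p x)⁻¹], ε, hε, isLocalIsometry_of_cometric hg hx₀
    (μ := fun x => (p x ^ 2)⁻¹) hε ?_ ?_ ?_, ?_⟩
  · filter_upwards [hpc, hpos] with x hpc hpos
    exact contDiffAt_const.mul (hpc.inv hpos.ne')
  · filter_upwards [hpc, hqc, hpos] with x hpc hqc hpos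
    exact hqc.mul (hpc.inv hpos.ne')
  · filter_upwards [hp.eventually_conserved hg hx₀ hp, hp.eventually_conserved hg hx₀ hq,
      hq.eventually_conserved hg hx₀ hq, hpc, hqc, hpos] with x hpp hpq hqq hpc hqc hpos
    rw [hp1, hp0] at hpp
    rw [hp1, hq1, hp0, hq0] at hpq
    rw [hq1, hq0] at hqq
    rw [hαα] at hpp
    rw [hαβ] at hpq
    rw [hββ] at hqq
    have hpp' : cometric (g x) (differential p x) (differential p x) = p x * p x := by linarith
    have hpq' : cometric (g x) (differential p x) (differential q x) = p x * q x := by linarith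
    have hqq' : cometric (g x) (differential q x) (differential q x) = ε + q x * q x := by linarith
    have hqp' := (cometric_comm (g x) (differential q x) (differential p x)).trans hpq'
    have hpd := hpc.differentiableAt (by simp)
    have hqd := hqc.differentiableAt (by simp)
    have h1 := differential_div (differentiableAt_const 1) hpd hpos.ne'
    have hone : differential (fun _ => 1) x = 0 := by
      funext i
      simp [differential, pderiv]
    rw [h1, differential_div hqd hpd hpos.ne', hone]
    simp only [cometric_combination, hpp', hpq', hqp', hqq']
    have hz (w : Fin 2 → ℝ) : cometric (g x) 0 w = 0 := by simp [cometric]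
    have hz' (w : Fin 2 → ℝ) : cometric (g x) w 0 = 0 := by simp [cometric]
    simp only [hz, hz']
    refine ⟨by positivity, ?_, ?_, ?_, ?_⟩
    · field_simp
      ring
    · field_simp
      ring
    · field_simp
      ring
    · simp [halfPlaneMetric]
  · filter_upwards [hpos] with x hpos
    simpa using hpos

/-- In curvature `1`, solutions `p`, `q`, `s` which at `x₀` have the values `0`, `0`, `1` and
orthonormal `dp`, `dq` and `ds = 0` are the coordinates of an isometric immersion into the unit
sphere. Composing it with the stereographic projection gives the chart. -/
lemma exists_isLocalIsometry_sphere (hg : IsConstCurvMetric Γ g 1 U) (hx₀ : x₀ ∈ U)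
    (hpos : ∀ v, 0 ≤ cometric (g x₀) v v) :
    ∃ φ : Plane → Plane, IsLocalIsometry g sphereMetric φ x₀ := by
  obtain ⟨v, hv⟩ := exists_cometric_ne_zero (hg.metric_symm x₀ hx₀) (hg.det_ne_zero x₀ hx₀)
  obtain ⟨α, β, ε, hε, hαα, hαβ, hββ⟩ := exists_orthonormal_covectors (hg.metric_symm x₀ hx₀)
    (hg.det_ne_zero x₀ hx₀) ((hpos v).lt_of_ne' hv)
  -- the metric is definite
  obtain rfl : ε = 1 := hε.resolve_right fun h => by
    have := hpos β
    rw [hββ, h] at this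
    norm_num at this
  obtain ⟨p, hp, hp0, hp1⟩ := exists_isHessianSolution_differential hg hx₀ 0 α
  obtain ⟨q, hq, hq0, hq1⟩ := exists_isHessianSolution_differential hg hx₀ 0 β
  obtain ⟨s, hs, hs0, hs1⟩ := exists_isHessianSolution_differential hg hx₀ 1 0
  have hpc := hp.eventually_contDiffAt
  have hqc := hq.eventually_contDiffAt
  have hsc := hs.eventually_contDiffAt
  have hspos : ∀ᶠ x in 𝓝 x₀, 0 < 1 + s x := by
    filter_upwards [hsc.self_of_nhds.continuousAt.eventually
      (lt_mem_nhds (show 0 < s x₀ by rw [hs0]; exact one_pos))] with x hx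
    linarith
  refine ⟨fun x => !₂[p x * (1 + s x)⁻¹, q x * (1 + s x)⁻¹], isLocalIsometry_of_cometric hg hx₀
    (μ := fun x => ((1 + s x) ^ 2)⁻¹) hε ?_ ?_ ?_⟩
  · filter_upwards [hpc, hsc, hspos] with x hpc hsc hspos
    exact hpc.mul ((contDiffAt_const.add hsc).inv hspos.ne')
  · filter_upwards [hqc, hsc, hspos] with x hqc hsc hspos
    exact hqc.mul ((contDiffAt_const.add hsc).inv hspos.ne')
  · filter_upwards [hp.eventually_conserved hg hx₀ hp, hp.eventually_conserved hg hx₀ hq,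
      hq.eventually_conserved hg hx₀ hq, hp.eventually_conserved hg hx₀ hs,
      hq.eventually_conserved hg hx₀ hs, hs.eventually_conserved hg hx₀ hs, hpc, hqc, hsc,
      hspos] with x hpp hpq hqq hps hqs hss hpc hqc hsc hspos
    have hz' (w : Fin 2 → ℝ) : cometric (g x₀) w 0 = 0 := by simp [cometric]
    simp only [hp1, hq1, hs1, hp0, hq0, hs0, hαα, hαβ, hββ, hz', mul_zero, mul_one,
      add_zero, zero_add, one_mul, ← eq_sub_iff_add_eq] at hpp hpq hqq hps hqs hss
    -- the image of the immersion lies in the unit sphere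
    have hgram := cometric_gram (g x) (differential p x) (differential q x) (differential s x)
    simp only [hpp, hpq, hqq, hps, hqs, hss] at hgram
    have hsphere : p x ^ 2 + q x ^ 2 + s x ^ 2 = 1 := by linear_combination -hgram
    have hsp := (cometric_comm (g x) (differential s x) (differential p x)).trans hps
    have hsq := (cometric_comm (g x) (differential s x) (differential q x)).trans hqs
    have hpd := hpc.differentiableAt (by simp)
    have hqd := hqc.differentiableAt (by simp)
    have hsd := hsc.differentiableAt (by simp)
    have hsd' : DifferentiableAt ℝ (fun y => 1 + s y) x := hsd.const_add 1
    have hd1 : differential (fun y => 1 + s y) x = differential s x := by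
      funext i
      simp only [differential]
      rw [pderiv_add i (differentiableAt_const 1) hsd]
      simp [pderiv]
    rw [differential_div hpd hsd' hspos.ne', differential_div hqd hsd' hspos.ne', hd1]
    simp only [cometric_combination, hpp, hpq, hqq, hps, hqs, hsp, hsq, hss]
    refine ⟨by positivity, ?_, ?_, ?_, ?_⟩
    · field_simp
      ring
    · field_simp
      ring
    · field_simp
      ring
    · have h1 : 1 + ((p x * (1 + s x)⁻¹) ^ 2 + (q x * (1 + s x)⁻¹) ^ 2) = 2 * (1 + s x)⁻¹ := by
        field_simp
        linear_combination hsphere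
      have h2 : !![1, 0; 0, 1] = (1 : Matrix (Fin 2) (Fin 2) ℝ) := Matrix.one_fin_two.symm
      rw [h2, sphereMetric]
      congr 1
      simp only [Matrix.cons_val_zero, Matrix.cons_val_one, h1]
      field_simp
      norm_num

/-- Up to a constant factor, a metric of constant Gauss curvature is locally isometric to one of
the model metrics. -/
theorem exists_isLocalIsometry (hg : IsConstCurvMetric Γ g K U) (hx₀ : x₀ ∈ U) :
    ∃ (c : ℝ) (φ : Plane → Plane), c ≠ 0 ∧
      ((∃ ε : ℝ, (ε = 1 ∨ ε = -1) ∧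
          IsLocalIsometry (fun x => c • g x) (fun _ => !![1, 0; 0, ε]) φ x₀) ∨
        IsLocalIsometry (fun x => c • g x) sphereMetric φ x₀ ∨
        ∃ ε : ℝ, (ε = 1 ∨ ε = -1) ∧ IsLocalIsometry (fun x => c • g x) (halfPlaneMetric ε) φ x₀ ∧
          ∀ᶠ x in 𝓝 x₀, 0 < φ x 0) := by
  rcases eq_or_ne K 0 with rfl | hK
  · obtain ⟨v, hv⟩ := exists_cometric_ne_zero (hg.metric_symm x₀ hx₀) (hg.det_ne_zero x₀ hx₀)
    obtain ⟨c, hc, hcv⟩ : ∃ c : ℝ, c ≠ 0 ∧ 0 < cometric (c • g x₀) v v := by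
      rcases lt_or_gt_of_ne hv with h | h
      · exact ⟨-1, by norm_num, by rw [cometric_neg]; linarith⟩
      · exact ⟨1, one_ne_zero, by rwa [one_smul]⟩
    have hg' := hg.smul hc
    rw [mul_zero] at hg'
    obtain ⟨φ, ε, hε, h⟩ := exists_isLocalIsometry_flat hg' hx₀ hcv
    exact ⟨c, φ, hc, Or.inl ⟨ε, hε, h⟩⟩
  · have hg' := hg.smul (neg_ne_zero.2 hK)
    rw [inv_neg, neg_mul, inv_mul_cancel₀ hK] at hg'
    -- only a definite metric of positive curvature has no multiple of curvature `-1` with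
    -- covectors of positive square
    by_cases hv : ∃ v, 0 < cometric (-K • g x₀) v v
    · obtain ⟨v, hv⟩ := hv
      obtain ⟨φ, ε, hε, h⟩ := exists_isLocalIsometry_halfPlane hg' hx₀ hv
      exact ⟨-K, φ, neg_ne_zero.2 hK, Or.inr (Or.inr ⟨ε, hε, h⟩)⟩
    · push Not at hv
      have hg'' := hg.smul hK
      rw [inv_mul_cancel₀ hK] at hg''
      obtain ⟨φ, h⟩ := exists_isLocalIsometry_sphere hg'' hx₀ fun v => by
        have := hv v
        rw [show -K • g x₀ = (-1 : ℝ) • (K • g x₀) by rw [smul_smul, neg_one_mul],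
          cometric_neg] at this
        linarith
      exact ⟨K, φ, hK, Or.inr (Or.inl h)⟩

end NormalForms

/-! ### Change of chart by a local isometry -/

section ModelCharts

variable {M : Type*} [TopologicalSpace M] [ChartedSpace Plane M]
  {e e' : OpenPartialHomeomorph M Plane}
  {g g' : Plane → Matrix (Fin 2) (Fin 2) ℝ} {φ ψ : Plane → Plane} {x₀ : Plane}

lemma IsLocalIsometry.congr (h : IsLocalIsometry g g' φ x₀) (hφ : φ =ᶠ[𝓝 x₀] ψ) :
    IsLocalIsometry g g' ψ x₀ := by
  filter_upwards [h, hφ.eventuallyEq_nhds] with x hx hφx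
  have hp (i a : Fin 2) : pderiv i (fun y => φ y a) x = pderiv i (fun y => ψ y a) x :=
    pderiv_congr i (hφx.mono fun y hy => congrArg (fun v : Plane => v a) hy)
  have hx0 : φ x = ψ x := hφx.self_of_nhds
  simp only [hp, hx0] at hx
  exact ⟨hx.1.congr_of_eventuallyEq hφx.symm, hx.2⟩

/-- The hypothesis of the inverse function theorem in terms of the Jacobian determinant. -/
lemma exists_hasFDerivAt_equiv {x : Plane} (hφ : ContDiffAt ℝ ∞ φ x)
    (hJ : pderiv 0 (fun y => φ y 0) x * pderiv 1 (fun y => φ y 1) x -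
      pderiv 1 (fun y => φ y 0) x * pderiv 0 (fun y => φ y 1) x ≠ 0) :
    ∃ L : Plane ≃L[ℝ] Plane, HasFDerivAt φ (L : Plane →L[ℝ] Plane) x := by
  have hd : DifferentiableAt ℝ φ x := hφ.differentiableAt (by simp)
  have happ (h : Plane) (a : Fin 2) : fderiv ℝ φ x h a =
      ∑ i, h i * pderiv i (fun y => φ y a) x := by
    have hh : h = ∑ i, h i • (EuclideanSpace.single i 1 : Plane) := by
      ext k; fin_cases k <;> simp
    simp only [pderiv_coord hd]
    conv_lhs => rw [hh, map_sum]
    simp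
  have hinj : Function.Injective (fderiv ℝ φ x : Plane →ₗ[ℝ] Plane) := by
    rw [← LinearMap.ker_eq_bot, LinearMap.ker_eq_bot']
    intro h hh
    have h0 := (happ h 0).symm.trans (congrArg (fun v : Plane => v 0) hh)
    have h1 := (happ h 1).symm.trans (congrArg (fun v : Plane => v 1) hh)
    simp only [Fin.sum_univ_two, PiLp.zero_apply] at h0 h1
    ext k
    apply mul_right_cancel₀ hJ
    simp only [PiLp.zero_apply, zero_mul]
    fin_cases k
    · simp only [Fin.zero_eta]
      linear_combination pderiv 1 (fun y => φ y 1) x * h0 - pderiv 1 (fun y => φ y 0) x * h1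
    · simp only [Fin.mk_one]
      linear_combination pderiv 0 (fun y => φ y 0) x * h1 - pderiv 0 (fun y => φ y 1) x * h0
  refine ⟨(LinearEquiv.ofInjectiveEndo _ hinj).toContinuousLinearEquiv, ?_⟩
  refine hd.hasFDerivAt.congr_fderiv ?_
  ext h : 1
  rfl

/-- A local diffeomorphism of the coordinate plane turns a chart into a chart near a given point,
whose domain can be chosen so small that a property which holds near that point holds on it. -/
lemma exists_chart (he : e ∈ IsManifold.maximalAtlas (𝓡 2) ∞ M) {P : Plane → Prop}
    {p : M} (hp : p ∈ e.source)
    (hφ : ∀ᶠ x in 𝓝 (e p), ContDiffAt ℝ ∞ φ x ∧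
      pderiv 0 (fun y => φ y 0) x * pderiv 1 (fun y => φ y 1) x -
        pderiv 1 (fun y => φ y 0) x * pderiv 0 (fun y => φ y 1) x ≠ 0)
    (hP : ∀ᶠ x in 𝓝 (e p), P x) :
    ∃ e' ∈ IsManifold.maximalAtlas (𝓡 2) ∞ M, p ∈ e'.source ∧ e'.source ⊆ e.source ∧
      ∀ q ∈ e'.source, (φ =ᶠ[𝓝 (e q)] fun y => e' (e.symm y)) ∧ ∀ᶠ x in 𝓝 (e q), P x := by
  obtain ⟨W, hW, hWo, hpW⟩ := eventually_nhds_iff.1 (hφ.and hP)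
  obtain ⟨L, hL⟩ := exists_hasFDerivAt_equiv (hW _ hpW).1.1 (hW _ hpW).1.2
  let Ψ₀ : OpenPartialHomeomorph Plane Plane :=
    (hW _ hpW).1.1.toOpenPartialHomeomorph φ hL (by simp)
  let Ψ := Ψ₀.restr W
  have hΨs : Ψ.source = Ψ₀.source ∩ W := by rw [Ψ₀.restr_source, hWo.interior_eq]
  have hΨ : (Ψ : Plane → Plane) = φ := rfl
  have hΨG : Ψ ∈ contDiffGroupoid ∞ (𝓡 2) := by
    rw [contDiffGroupoid, mem_groupoid_of_pregroupoid]
    have h1 : ContDiffOn ℝ ∞ Ψ Ψ.source := fun x hx =>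
      (hW x (hΨs ▸ hx).2).1.1.contDiffWithinAt
    have h2 : ContDiffOn ℝ ∞ Ψ.symm Ψ.target := fun y hy => by
      have hy' : Ψ.symm y ∈ W := (hΨs ▸ Ψ.map_target hy).2
      obtain ⟨L', hL'⟩ := exists_hasFDerivAt_equiv (hW _ hy').1.1 (hW _ hy').1.2
      exact (Ψ.contDiffAt_symm hy hL' (hW _ hy').1.1).contDiffWithinAt
    refine ⟨?_, ?_⟩
    · simpa [contDiffPregroupoid, Function.comp_def] using h1
    · simpa [contDiffPregroupoid, Function.comp_def] using h2
  refine ⟨e.trans Ψ, ?_, ?_, fun q hq => ?_, fun q hq => ?_⟩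
  · refine mem_maximalAtlas_iff.2 fun c hc => ⟨?_, ?_⟩
    · rw [OpenPartialHomeomorph.trans_symm_eq_symm_trans_symm, OpenPartialHomeomorph.trans_assoc]
      exact (contDiffGroupoid ∞ (𝓡 2)).trans ((contDiffGroupoid ∞ (𝓡 2)).symm hΨG)
        (mem_maximalAtlas_iff.1 he c hc).1
    · rw [← OpenPartialHomeomorph.trans_assoc]
      exact (contDiffGroupoid ∞ (𝓡 2)).trans
        (mem_maximalAtlas_iff.1 he c hc).2 hΨG
  · rw [e.trans_source]
    exact ⟨hp, hΨs ▸ ⟨(hW _ hpW).1.1.mem_toOpenPartialHomeomorph_source hL (by simp), hpW⟩⟩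
  · rw [e.trans_source] at hq
    exact hq.1
  · rw [e.trans_source] at hq
    refine ⟨?_, ?_⟩
    · filter_upwards [e.open_target.mem_nhds (e.map_source hq.1)] with y hy
      simp [hΨ, e.right_inv hy]
    · filter_upwards [hWo.mem_nhds (hΨs ▸ hq.2 : e q ∈ Ψ₀.source ∩ W).2] with y hy
      exact (hW y hy).2

lemma pderiv_comp {f : Plane → ℝ} {x : Plane} (hf : DifferentiableAt ℝ f (φ x))
    (hφ : DifferentiableAt ℝ φ x) (i : Fin 2) :
    pderiv i (fun y => f (φ y)) x =
      ∑ c, pderiv i (fun y => φ y c) x * pderiv c f (φ x) := by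
  have h := congrArg (fun A : Plane →L[ℝ] ℝ => A (EuclideanSpace.single i 1))
    (hf.hasFDerivAt.comp x hφ.hasFDerivAt).fderiv
  refine h.trans ((fderiv_apply_eq_sum f (φ x) _).trans ?_)
  refine Finset.sum_congr rfl fun c _ => ?_
  rw [pderiv_coord hφ]
  rfl

lemma eq_zero_of_sum_mul_eq_zero {J : Fin 2 → Fin 2 → ℝ}
    (hJ : J 0 0 * J 1 1 - J 1 0 * J 0 1 ≠ 0) {X : Fin 2 → ℝ} (h : ∀ i, ∑ a, X a * J i a = 0)
    (a : Fin 2) : X a = 0 := by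
  have h0 := h 0
  have h1 := h 1
  simp only [Fin.sum_univ_two] at h0 h1
  apply mul_right_cancel₀ hJ
  rw [zero_mul]
  fin_cases a
  · simp only [Fin.zero_eta]
    linear_combination J 1 1 * h0 - J 0 1 * h1
  · simp only [Fin.mk_one]
    linear_combination J 0 0 * h1 - J 1 0 * h0

variable [IsManifold (𝓡 2) ∞ M] {cov : Connection M}

lemma IsMetricInChart.const_smul (hg : IsMetricInChart cov e g)
    (hd : ∀ x ∈ e.target, ∀ i j, DifferentiableAt ℝ (fun y => g y i j) x) (c : ℝ) :
    IsMetricInChart cov e (fun x => c • g x) := by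
  intro x hx l i j
  have h1 : pderiv l (fun y => (c • g y) i j) x = c * pderiv l (fun y => g y i j) x :=
    pderiv_const_mul l c (hd x hx i j)
  rw [h1, hg x hx, Finset.mul_sum]
  refine Finset.sum_congr rfl fun m _ => ?_
  simp only [Matrix.smul_apply, smul_eq_mul]
  ring

/-- If the transition map is a local isometry and the first metric is parallel, then so is the
second one. -/
lemma IsMetricInChart.of_isLocalIsometry (he : e ∈ IsManifold.maximalAtlas (𝓡 2) ∞ M)
    (he' : e' ∈ IsManifold.maximalAtlas (𝓡 2) ∞ M) (hsub : e'.source ⊆ e.source)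
    (hg : IsMetricInChart cov e g)
    (hiso : ∀ q ∈ e'.source, IsLocalIsometry g g' (fun y => e' (e.symm y)) (e q))
    (hd : ∀ y ∈ e'.target, ∀ a b, DifferentiableAt ℝ (fun y => g' y a b) y) :
    IsMetricInChart cov e' g' := by
  intro y hy
  obtain ⟨q, hq, rfl⟩ : ∃ q ∈ e'.source, e' q = y := ⟨e'.symm y, e'.map_target hy, e'.right_inv hy⟩
  have hqe := hsub hq
  set φ : Plane → Plane := fun y => e' (e.symm y) with hφ
  have hφq : φ (e q) = e' q := by rw [hφ]; simp only [e.left_inv hqe]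
  have hφc : ContDiffAt ℝ ∞ φ (e q) := contDiffAt_transition he he' hqe hq
  have hφd : DifferentiableAt ℝ φ (e q) := hφc.differentiableAt (by simp)
  let J (i a : Fin 2) : Plane → ℝ := pderiv i (fun y => φ y a)
  let G (a b : Fin 2) : Plane → ℝ := fun y => g' (φ y) a b
  have hJd (i a : Fin 2) : DifferentiableAt ℝ (J i a) (e q) :=
    (contDiffAt_pderiv (m := 1) (n := ∞) ((contDiffAt_coord a).comp (e q) hφc)
      (by rw [one_add_one_eq_two]; exact ENat.LEInfty.out) i).differentiableAt one_ne_zero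
  have hg'd (a b : Fin 2) : DifferentiableAt ℝ (fun y => g' y a b) (φ (e q)) := by
    rw [hφq]
    exact hd _ hy a b
  have hGd (a b : Fin 2) : DifferentiableAt ℝ (G a b) (e q) :=
    DifferentiableAt.comp (g := fun y => g' y a b) (e q) (hg'd a b) hφd
  have hG (l a b : Fin 2) : pderiv l (G a b) (e q) =
      ∑ c, J l c (e q) * pderiv c (fun y => g' y a b) (φ (e q)) := pderiv_comp (hg'd a b) hφd l
  have hpull (i j : Fin 2) : g (e q) i j = ∑ a, ∑ b, G a b (e q) * (J i a (e q) * J j b (e q)) :=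
    (hiso q hq).self_of_nhds.2.2 i j
  have htr (i j k : Fin 2) : ∑ m, christoffel cov e i j m (e q) * J m k (e q) =
      pderiv i (J j k) (e q) + ∑ a, ∑ b, J i a (e q) * J j b (e q) *
        christoffel cov e' a b k (e' q) := christoffel_transform cov he he' hqe hq i j k
  -- differentiating the isometry equation shows that the pullback of the covariant derivative
  -- of the second metric vanishes
  have key (l i j : Fin 2) : ∑ b, (∑ a, (∑ c, (pderiv c (fun y => g' y a b) (φ (e q)) -
      ∑ m, (christoffel cov e' c a m (e' q) * G m b (e q) +
        christoffel cov e' c b m (e' q) * G a m (e q))) * J l c (e q)) *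
      J i a (e q)) * J j b (e q) = 0 := by
    have h1 := hg (e q) (e.map_source hqe) l i j
    have h2 : (fun y => g y i j) =ᶠ[𝓝 (e q)] fun y => ∑ a, ∑ b, G a b y * (J i a y * J j b y) :=
      (hiso q hq).mono fun y hy => hy.2.2 i j
    rw [pderiv_congr l h2] at h1
    have hi (k : Fin 2) := htr l i k
    have hj (k : Fin 2) := htr l j k
    have hi0 := hi 0
    have hi1 := hi 1
    have hj0 := hj 0
    have hj1 := hj 1
    simp only [Fin.sum_univ_two, hpull] at h1 hi0 hi1 hj0 hj1 hG ⊢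
    clear_value J G
    simp (disch := fun_prop) only [pderiv_add, pderiv_mul, hG] at h1
    linear_combination h1 +
      (G 0 0 (e q) * J j 0 (e q) + G 0 1 (e q) * J j 1 (e q)) * hi0 +
      (G 1 0 (e q) * J j 0 (e q) + G 1 1 (e q) * J j 1 (e q)) * hi1 +
      (G 0 0 (e q) * J i 0 (e q) + G 1 0 (e q) * J i 1 (e q)) * hj0 +
      (G 0 1 (e q) * J i 0 (e q) + G 1 1 (e q) * J i 1 (e q)) * hj1
  have hJ : J 0 0 (e q) * J 1 1 (e q) - J 1 0 (e q) * J 0 1 (e q) ≠ 0 :=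
    (hiso q hq).self_of_nhds.2.1
  -- the Jacobian matrix is invertible, so it can be cancelled in all three indices
  intro l i j
  have h1 (l i : Fin 2) := eq_zero_of_sum_mul_eq_zero (J := fun i a => J i a (e q)) hJ (key l i)
  have h2 (l a : Fin 2) (b : Fin 2) := eq_zero_of_sum_mul_eq_zero (J := fun i a => J i a (e q)) hJ
    (fun i => h1 l i b) a
  have h3 := eq_zero_of_sum_mul_eq_zero (J := fun i a => J i a (e q)) hJ (fun l => h2 l i j) l
  simp only [G, hφq] at h3
  exact sub_eq_zero.1 h3

end ModelCharts

/-! ### Model atlases -/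

section ModelAtlas

variable {M : Type*} [TopologicalSpace M] [ChartedSpace Plane M] [IsManifold (𝓡 2) ∞ M]
  {e : OpenPartialHomeomorph M Plane} {cov : Connection M}
  {g : Plane → Matrix (Fin 2) (Fin 2) ℝ} {K : ℝ}

lemma isConstCurvMetric_christoffel (htorsion : cov.torsion = 0)
    (he : e ∈ IsManifold.maximalAtlas (𝓡 2) ∞ M)
    (hgd : ∀ i j, ContDiffOn ℝ ∞ (fun x => g x i j) e.target)
    (hsymm : ∀ x ∈ e.target, (g x).IsSymm ∧ (g x).det ≠ 0) (hg : IsMetricInChart cov e g)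
    (hK : ∀ x ∈ e.target, gaussCurvature cov e g x = K) :
    IsConstCurvMetric (christoffel cov e) g K e.target where
  isOpen := e.open_target
  contDiffOn_christoffel := contDiffOn_christoffel (by simp) htorsion he hg hgd hsymm
  christoffel_symm _ hx i j k := christoffel_symm htorsion he hx i j k
  contDiffOn_metric := hgd
  metric_symm x hx := (hsymm x hx).1
  det_ne_zero x hx := (hsymm x hx).2
  parallel := hg
  curvature x hx := (div_eq_iff (hsymm x hx).2).1 (hK x hx)

/-- A connection with a constant parallel metric, of any signature, is that of the flat model. -/
lemma IsMetricInChart.flatMetric_of_const (htorsion : cov.torsion = 0)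
    (he : e ∈ IsManifold.maximalAtlas (𝓡 2) ∞ M) {m : Matrix (Fin 2) (Fin 2) ℝ} (hm : m.IsSymm)
    (hdet : m.det ≠ 0) (hg : IsMetricInChart cov e fun _ => m) :
    IsMetricInChart cov e flatMetric := by
  have hΓ (x) (hx : x ∈ e.target) (i j k : Fin 2) : christoffel cov e i j k x = 0 := by
    rw [koszul_formula htorsion he hg hx hm hdet]
    simp [pderiv]
  intro x hx l i j
  simp only [hΓ x hx, zero_mul, add_zero, Finset.sum_const_zero]
  simp [pderiv, flatMetric]

/-- The charts in which the connection is that of one of the four model metrics. -/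
def IsModelChart (cov : Connection M) (e : OpenPartialHomeomorph M Plane) : Prop :=
  IsMetricInChart cov e flatMetric ∨
    IsMetricInChart cov e sphereMetric ∨
    ((∀ x ∈ e.target, 0 < x 0) ∧ IsMetricInChart cov e (halfPlaneMetric 1)) ∨
    ((∀ x ∈ e.target, 0 < x 0) ∧ IsMetricInChart cov e (halfPlaneMetric (-1)))

lemma exists_isModelChart (htorsion : cov.torsion = 0)
    (he : e ∈ IsManifold.maximalAtlas (𝓡 2) ∞ M)
    (hgd : ∀ i j, ContDiffOn ℝ ∞ (fun x => g x i j) e.target)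
    (hsymm : ∀ x ∈ e.target, (g x).IsSymm ∧ (g x).det ≠ 0) (hg : IsMetricInChart cov e g)
    (hK : ∀ x ∈ e.target, gaussCurvature cov e g x = K) {p : M} (hp : p ∈ e.source) :
    ∃ e' ∈ IsManifold.maximalAtlas (𝓡 2) ∞ M, p ∈ e'.source ∧ IsModelChart cov e' := by
  have hcc := isConstCurvMetric_christoffel htorsion he hgd hsymm hg hK
  obtain ⟨c, φ, -, hφ⟩ := exists_isLocalIsometry hcc (e.map_source hp)
  have hgc := hg.const_smul (fun x hx i j => hcc.differentiableAt_metric hx i j) c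
  -- a local isometry to `g'` gives a chart in which `g'` is parallel; `P` is the condition on the
  -- coordinates under which `g'` is regular
  have chart {g' : Plane → Matrix (Fin 2) (Fin 2) ℝ} {P : Plane → Prop}
      (h : IsLocalIsometry (fun x => c • g x) g' φ (e p)) (hP : ∀ᶠ x in 𝓝 (e p), P (φ x))
      (hd : ∀ y, P y → ∀ a b, DifferentiableAt ℝ (fun y => g' y a b) y) :
      ∃ e' ∈ IsManifold.maximalAtlas (𝓡 2) ∞ M, p ∈ e'.source ∧ (∀ y ∈ e'.target, P y) ∧
        IsMetricInChart cov e' g' := by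
    obtain ⟨e', he', hp', hsub, hloc⟩ := exists_chart (φ := φ) he hp
      (h.mono fun x hx => ⟨hx.1, hx.2.1⟩) (h.eventually_nhds.and hP)
    have hPe (y) (hy : y ∈ e'.target) : P y := by
      have hq := e'.map_target hy
      have h1 := (hloc _ hq).2.self_of_nhds.2
      rw [(hloc _ hq).1.self_of_nhds] at h1
      simp only [e.left_inv (hsub hq), e'.right_inv hy] at h1
      exact h1
    refine ⟨e', he', hp', hPe, hgc.of_isLocalIsometry he he' hsub (fun q hq => ?_)
      fun y hy => hd y (hPe y hy)⟩
    have hiso : IsLocalIsometry (fun x => c • g x) g' φ (e q) := (hloc q hq).2.self_of_nhds.1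
    exact hiso.congr (hloc q hq).1
  have diff {g' : Plane → Matrix (Fin 2) (Fin 2) ℝ} {y : Plane}
      (h : ∀ i j, ContDiffAt ℝ 1 (fun y => g' y i j) y) (i j : Fin 2) :
      DifferentiableAt ℝ (fun y => g' y i j) y := (h i j).differentiableAt one_ne_zero
  rcases hφ with ⟨ε, hε, h⟩ | h | ⟨ε, hε, h, hpos⟩
  · obtain ⟨e', he', hp', -, hm⟩ := chart (P := fun _ => True) h
      (Eventually.of_forall fun _ => trivial)
      fun _ _ _ _ => differentiableAt_const _
    refine ⟨e', he', hp', Or.inl (hm.flatMetric_of_const htorsion he' ?_ ?_)⟩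
    · ext i j
      fin_cases i <;> fin_cases j <;> rfl
    · rcases hε with rfl | rfl <;> simp [Matrix.det_fin_two_of]
  · obtain ⟨e', he', hp', -, hm⟩ := chart (P := fun _ => True) h
      (Eventually.of_forall fun _ => trivial)
      fun y _ => diff (sphereMetric_regular y).1
    exact ⟨e', he', hp', Or.inr (Or.inl hm)⟩
  · have hε0 : ε ≠ 0 := by rcases hε with rfl | rfl <;> norm_num
    obtain ⟨e', he', hp', hpos', hm⟩ := chart (P := fun y => 0 < y 0) h hpos
      fun y hy => diff (halfPlaneMetric_regular hε0 hy).1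
    rcases hε with rfl | rfl
    · exact ⟨e', he', hp', Or.inr (Or.inr (Or.inl ⟨hpos', hm⟩))⟩
    · exact ⟨e', he', hp', Or.inr (Or.inr (Or.inr ⟨hpos', hm⟩))⟩

theorem IsTypeCAtlas.exists_isTypeCModelAtlas (htorsion : cov.torsion = 0)
    {𝒜 : Set (OpenPartialHomeomorph M Plane)} (h : IsTypeCAtlas ∞ cov 𝒜) :
    ∃ 𝒜' : Set (OpenPartialHomeomorph M Plane), IsTypeCModelAtlas cov 𝒜' := by
  refine ⟨{e' | e' ∈ IsManifold.maximalAtlas (𝓡 2) ∞ M ∧ IsModelChart cov e'},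
    ⟨fun e he => he.1, fun p => ?_⟩, fun e he => he.2⟩
  obtain ⟨e, he, hp⟩ := h.1.2 p
  obtain ⟨g, K, hgd, hsymm, hg, hK⟩ := h.2 e he
  obtain ⟨e', he', hp', hm⟩ := exists_isModelChart htorsion (h.1.1 he) hgd hsymm hg hK hp
  exact ⟨e', ⟨he', hm⟩, hp'⟩

end ModelAtlas

end AffineSurface

end


theorem mainTheorem6 {M : Type*} [TopologicalSpace M] [T2Space M] [SecondCountableTopology M]
    [ConnectedSpace M] [ChartedSpace AffineSurface.Plane M] [IsManifold (𝓡 2) ∞ M]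
    (cov : AffineSurface.Connection M) [cov.ContMDiffCovariantDerivative ∞]
    (htorsion : cov.torsion = 0) (hsymm : AffineSurface.IsLocallySymmetric cov) :
    (∀ 𝒜 : Set (OpenPartialHomeomorph M AffineSurface.Plane),
      AffineSurface.IsTypeAAtlas cov 𝒜 → AffineSurface.IsRealAnalyticAtlas cov 𝒜) ∧
    (∀ 𝒜 : Set (OpenPartialHomeomorph M AffineSurface.Plane),
      AffineSurface.IsTypeBAtlas cov 𝒜 → AffineSurface.IsRealAnalyticAtlas cov 𝒜) ∧
    (∀ 𝒜 : Set (OpenPartialHomeomorph M AffineSurface.Plane),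
      AffineSurface.IsTypeCAtlas ∞ cov 𝒜 →
        ∃ 𝒜' : Set (OpenPartialHomeomorph M AffineSurface.Plane),
          AffineSurface.IsTypeCModelAtlas cov 𝒜' ∧ AffineSurface.IsRealAnalyticAtlas cov 𝒜') ∧
    (∀ 𝒜 : Set (OpenPartialHomeomorph M AffineSurface.Plane),
      AffineSurface.IsTypeCModelAtlas cov 𝒜 → AffineSurface.IsRealAnalyticAtlas cov 𝒜) ∧
    (∀ 𝒜 : Set (OpenPartialHomeomorph M AffineSurface.Plane),
      AffineSurface.IsTypeCAtlas ω cov 𝒜 → AffineSurface.IsRealAnalyticAtlas cov 𝒜) := by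
  refine ⟨fun 𝒜 h => h.isRealAnalyticAtlas, fun 𝒜 h => h.isRealAnalyticAtlas, fun 𝒜 h => ?_,
    fun 𝒜 h => h.isRealAnalyticAtlas htorsion, fun 𝒜 h => h.isRealAnalyticAtlas htorsion⟩
  obtain ⟨𝒜', h'⟩ := h.exists_isTypeCModelAtlas htorsion
  exact ⟨𝒜', h', h'.isRealAnalyticAtlas htorsion⟩
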